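/- Let $\mathbb{F}$ be an algebraically closed field of characteristic zero. A Lie superalgebra $\mathfrak{g}=\mathfrak{g}_{\bar 0}\oplus\mathfrak{g}_{\bar 1}$ over $\mathbb{F}$ is called two-step nilpotent if $[\mathfrak{g},\mathfrak{g}]\neq 0$ and $[\mathfrak{g},[\mathfrak{g},\mathfrak{g}]]=0$, and a Heisenberg Lie superalgebra if it is two-step nilpotent with one-dimensional center. For a finite-dimensional Lie superalgebra $\mathfrak{g}$ let $C^n(\mathfrak{g},\mathfrak{g})=\mathfrak{g}\otimes\bigwedge^n\mathfrak{g}^*$ be the space of $n$-linear maps $f:\mathfrak{g}^n\to\mathfrak{g}$ with $f(x_{\sigma(1)},\dots,x_{\sigma(n)})=\varepsilon(\sigma)\gamma(x,\sigma)f(x_1,\dots,x_n)$ for homogeneous $x_i$ and $\sigma\in S_n$, where $\varepsilon(\sigma)$ is the sign of $\sigma$ and $\gamma(x,\sigma)=\prod_{i<j,\ \sigma(i)>\sigma(j)}(-1)^{|x_{\sigma(i)}||x_{\sigma(j)}|}$. The differential $\mathrm{d}:C^n(\mathfrak{g},\mathfrak{g})\to C^{n+1}(\mathfrak{g},\mathfrak{g})$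 is given, for homogeneous $f$ and $x_0,\dots,x_n$, by $$\begin{aligned}(\mathrm{d}f)(x_0,\dots,x_n)={}&\sum_{i}(-1)^{i+|x_i|(|f|+|x_0|+\cdots+|x_{i-1}|)}[x_i,f(x_0,\dots,\widehat{x_i},\dots,x_n)]\\&+\sum_{i<j}(-1)^{j+|x_j|(|x_{i+1}|+\cdots+|x_{j-1}|)}f(x_0,\dots,x_{i-1},[x_i,x_j],x_{i+1},\dots,\widehat{x_j},\dots,x_n),\end{aligned}$$ and $\mathrm{H}^n(\mathfrak{g},\mathfrak{g})$ is the space of $n$-cocycles modulo $n$-coboundaries. The cup product of $f\in C^p(\mathfrak{g},\mathfrak{g})$ and $h\in C^q(\mathfrak{g},\mathfrak{g})$ is the bilinear operation given, for homogeneous $h$ and $x_1,\dots,x_{p+q}$, by $$(f\cup h)(x_1,\dots,x_{p+q})=\frac{1}{p!\,q!}\sum_{\sigma\in S_{p+q}}(-1)^{(|x_{\sigma(1)}|+\cdots+|x_{\sigma(p)}|)|h|}\varepsilon(\sigma)\gamma(x,\sigma)\,[f(x_{\sigma(1)},\dots,x_{\sigma(p)}),h(x_{\sigma(p+1)},\dots,x_{\sigma(p+q)})].$$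 Theorem. Let $\mathfrak{g}$ be a finite-dimensional Heisenberg Lie superalgebra. Then the cup product on $\mathrm{H}^\bullet(\mathfrak{g},\mathfrak{g})=\bigoplus_{n\ge 0}\mathrm{H}^n(\mathfrak{g},\mathfrak{g})$ is trivial: for all $p,q\ge 0$ and all cocycles $f\in C^p(\mathfrak{g},\mathfrak{g})$ and $h\in C^q(\mathfrak{g},\mathfrak{g})$, the cochain $f\cup h$ is a cocycle and its class $[f]\cup[h]$ in $\mathrm{H}^{p+q}(\mathfrak{g},\mathfrak{g})$ is zero. In particular, the cup product on the adjoint cohomology is trivial for (1) $\mathfrak{h}_{2m,n}$ ($m,n\geq 0$), with basis $z,x_1,\dots,x_{2m}$ of the even part and $y_1,\dots,y_n$ of the odd part, in which $[x_i,x_{m+i}]=[y_j,y_j]=z$ for $1\le i\le m$, $1\le j\le n$, and all other brackets of basis elements, up to skew-supersymmetry, are zero; (2) $\mathfrak{ba}_n$ ($n\geq 0$), with basis $x_1,\dots,x_n$ of the even part and $z,y_1,\dots,y_n$ of the odd part, in which $[x_i,y_i]=z$ for $1\le i\le n$, and all other brackets of basis elements, up to skew-supersymmetry, are zero. (For $m=n=0$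 in (1) and $n=0$ in (2) the algebra is abelian, and the assertion still holds.) -/

import Mathlib

open scoped BigOperators

/-- A Lie superalgebra structure on the vector space `g` over `F`: a `ℤ/2`-grading
`g = g₀ ⊕ g₁` and an even bilinear bracket satisfying skew-supersymmetry and the super Jacobi
identity.  `part i` is the space of elements of degree `i`; its elements are called homogeneous. -/
structure LieSuperalgebra (F : Type*) (g : Type*) [Field F] [AddCommGroup g] [Module F g] where
  part : ZMod 2 → Submodule F g
  isInternal : DirectSum.IsInternal part
  bracket : g →ₗ[F] g →ₗ[F] g
  bracket_mem : ∀ (i j : ZMod 2), ∀ x ∈ part i, ∀ y ∈ part j, bracket x y ∈ part (i + j)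
  skew : ∀ (i j : ZMod 2), ∀ x ∈ part i, ∀ y ∈ part j,
    bracket x y = -((-1 : ℤˣ) ^ (i * j) • bracket y x)
  jacobi : ∀ (i j : ZMod 2), ∀ x ∈ part i, ∀ y ∈ part j, ∀ w : g,
    bracket x (bracket y w)
      = bracket (bracket x y) w + (-1 : ℤˣ) ^ (i * j) • bracket y (bracket x w)

namespace LieSuperalgebra

/-- For a tuple of homogeneous elements `x₀, …, x_{n-1}` of degrees `e₀, …, e_{n-1}` and a
permutation `σ`, the sign `ε(σ) γ(x, σ)`, where `ε` is the sign of `σ` and `γ(x, σ)` is the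
product of `(-1)^{|x_{σ(i)}| |x_{σ(j)}|}` over the inversions `(i, j)` of `σ`. -/
def permSign {n : ℕ} (e : Fin n → ZMod 2) (σ : Equiv.Perm (Fin n)) : ℤˣ :=
  Equiv.Perm.sign σ *
    ∏ i : Fin n, ∏ j : Fin n,
      if i < j ∧ σ j < σ i then (-1 : ℤˣ) ^ (e (σ i) * e (σ j)) else 1

variable {F : Type*} {g : Type*} [Field F] [AddCommGroup g] [Module F g]

/-- The projection of `g = g₀ ⊕ g₁` onto its homogeneous component of degree `i`. -/
noncomputable def proj (L : LieSuperalgebra F g) (i : ZMod 2) : g →ₗ[F] g :=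
  letI := L.isInternal.chooseDecomposition
  (L.part i).subtype ∘ₗ DirectSum.component F (ZMod 2) (fun k => L.part k) i ∘ₗ
    (DirectSum.decomposeLinearEquiv L.part).toLinearMap

/-! ### The centre, the lower central series, Heisenberg Lie superalgebras -/

/-- The centre `C(g)`. -/
def center (L : LieSuperalgebra F g) : Submodule F g := LinearMap.ker L.bracket

/-- The lower central series `g⁰ = g`, `gⁱ⁺¹ = [g, gⁱ]`. -/
def lowerCentral (L : LieSuperalgebra F g) : ℕ → Submodule F g
  | 0 => ⊤
  | i + 1 => Submodule.span F {w | ∃ x : g, ∃ y ∈ lowerCentral L i, L.bracket x y = w}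

/-- `g` is `n`-step nilpotent if `gⁿ⁻¹ ≠ 0` and `gⁿ = 0`; here `n = 2`. -/
def IsTwoStepNilpotent (L : LieSuperalgebra F g) : Prop :=
  L.lowerCentral 1 ≠ ⊥ ∧ L.lowerCentral 2 = ⊥

/-- A Heisenberg Lie superalgebra: two-step nilpotent with one-dimensional centre. -/
def IsHeisenberg (L : LieSuperalgebra F g) : Prop :=
  L.IsTwoStepNilpotent ∧ Module.finrank F L.center = 1

/-! ### Cochains with coefficients in the adjoint module

For finite-dimensional `g`, the space `g ⊗ ⋀ⁿ g*` is the space of `n`-linear maps `gⁿ → g` that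
are super-alternating. A multilinear map is determined by its values on tuples of homogeneous
elements, and all sign rules are stated on such tuples. -/

/-- `f` precomposed with the projections onto the components of degrees `e₀, …, e_{n-1}`.
Every multilinear map is the sum of its restrictions over all `e`. -/
noncomputable def restrict (L : LieSuperalgebra F g) {n : ℕ} (e : Fin n → ZMod 2)
    (f : MultilinearMap F (fun _ : Fin n => g) g) : MultilinearMap F (fun _ : Fin n => g) g :=
  f.compLinearMap (fun i => L.proj (e i))

/-- The component of parity `δ` of the multilinear map `f`: on homogeneous elements
`x₀, …, x_{n-1}` its value is the component of `f (x₀, …, x_{n-1})` of degree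
`δ + |x₀| + ⋯ + |x_{n-1}|`. -/
noncomputable def parityPart (L : LieSuperalgebra F g) {n : ℕ} (δ : ZMod 2)
    (f : MultilinearMap F (fun _ : Fin n => g) g) : MultilinearMap F (fun _ : Fin n => g) g :=
  ∑ e : Fin n → ZMod 2, (L.proj (δ + ∑ i, e i)).compMultilinearMap (L.restrict e f)

/-- The cochain space `Cⁿ(g, g)`: the `n`-linear maps `f : gⁿ → g` such that
`f (x_{σ(0)}, …, x_{σ(n-1)}) = ε(σ) γ(x, σ) f (x₀, …, x_{n-1})` for all homogeneous `xᵢ`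
and all permutations `σ`. -/
def cochains (L : LieSuperalgebra F g) (n : ℕ) :
    Submodule F (MultilinearMap F (fun _ : Fin n => g) g) where
  carrier := {f | ∀ (e : Fin n → ZMod 2) (x : Fin n → g), (∀ i, x i ∈ L.part (e i)) →
    ∀ σ : Equiv.Perm (Fin n), f (fun i => x (σ i)) = permSign e σ • f x}
  zero_mem' := by
    intro e x _ σ
    simp
  add_mem' := by
    intro f₁ f₂ h₁ h₂ e x hx σ
    simp only [add_apply, h₁ e x hx σ, h₂ e x hx σ, smul_add]
  smul_mem' := by
    intro c f h e x hx σ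
    simp only [smul_apply, h e x hx σ]
    exact smul_comm c (permSign e σ) (f x)

/-! ### The differential -/

/-- The multilinear map `(x₀, …, xₙ) ↦ [xᵢ, f (x₀, …, x̂ᵢ, …, xₙ)]`. -/
noncomputable def actTerm (L : LieSuperalgebra F g) {n : ℕ} (i : Fin (n + 1))
    (f : MultilinearMap F (fun _ : Fin n => g) g) :
    MultilinearMap F (fun _ : Fin (n + 1) => g) g :=
  LinearMap.uncurryMid (M := fun _ : Fin (n + 1) => g) i
    { toFun := fun v => (L.bracket v).compMultilinearMap f
      map_add' := by
        intro v w
        ext x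
        simp
      map_smul' := by
        intro c v
        ext x
        simp }

/-- The multilinear map `(x₀, …, xₙ) ↦ f (x₀, …, [xᵢ, xⱼ], …, x̂ⱼ, …, xₙ)`, in which
`[xᵢ, xⱼ]` stands in the place of `xᵢ` and `xⱼ` is omitted; here `i = j.succAbove k`, that is,
`xᵢ` is the `k`-th entry of the tuple after the omission of `xⱼ`. -/
noncomputable def bracketTerm (L : LieSuperalgebra F g) {n : ℕ} (j : Fin (n + 1)) (k : Fin n)
    (f : MultilinearMap F (fun _ : Fin n => g) g) :
    MultilinearMap F (fun _ : Fin (n + 1) => g) g :=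
  LinearMap.uncurryMid (M := fun _ : Fin (n + 1) => g) j
    { toFun := fun v =>
        f.compLinearMap (Function.update (fun _ => LinearMap.id) k (L.bracket.flip v))
      map_add' := by
        intro v w
        rw [map_add]
        exact congrArg (fun m => m f) (MultilinearMap.map_update_add
          (MultilinearMap.compLinearMapMultilinear (R := F) (M₁ := fun _ : Fin n => g)
            (M₁' := fun _ : Fin n => g) (M₂ := g)) (fun _ => LinearMap.id) k
          (L.bracket.flip v) (L.bracket.flip w))
      map_smul' := by
        intro c v
        rw [map_smul]
        exact congrArg (fun m => m f) (MultilinearMap.map_update_smul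
          (MultilinearMap.compLinearMapMultilinear (R := F) (M₁ := fun _ : Fin n => g)
            (M₁' := fun _ : Fin n => g) (M₂ := g)) (fun _ => LinearMap.id) k
          c (L.bracket.flip v)) }

theorem restrict_add (L : LieSuperalgebra F g) {n : ℕ} (e : Fin n → ZMod 2)
    (f₁ f₂ : MultilinearMap F (fun _ : Fin n => g) g) :
    L.restrict e (f₁ + f₂) = L.restrict e f₁ + L.restrict e f₂ := rfl

theorem restrict_smul (L : LieSuperalgebra F g) {n : ℕ} (e : Fin n → ZMod 2) (c : F)
    (f : MultilinearMap F (fun _ : Fin n => g) g) :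
    L.restrict e (c • f) = c • L.restrict e f := rfl

theorem parityPart_add (L : LieSuperalgebra F g) {n : ℕ} (δ : ZMod 2)
    (f₁ f₂ : MultilinearMap F (fun _ : Fin n => g) g) :
    L.parityPart δ (f₁ + f₂) = L.parityPart δ f₁ + L.parityPart δ f₂ := by
  simp only [parityPart, restrict_add, ← Finset.sum_add_distrib]
  refine Finset.sum_congr rfl fun e _ => ?_
  ext x
  simp

theorem parityPart_smul (L : LieSuperalgebra F g) {n : ℕ} (δ : ZMod 2) (c : F)
    (f : MultilinearMap F (fun _ : Fin n => g) g) :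
    L.parityPart δ (c • f) = c • L.parityPart δ f := by
  simp only [parityPart, restrict_smul, Finset.smul_sum]
  refine Finset.sum_congr rfl fun e _ => ?_
  ext x
  simp

theorem actTerm_add (L : LieSuperalgebra F g) {n : ℕ} (i : Fin (n + 1))
    (f₁ f₂ : MultilinearMap F (fun _ : Fin n => g) g) :
    L.actTerm i (f₁ + f₂) = L.actTerm i f₁ + L.actTerm i f₂ := by
  ext x
  simp [actTerm]

theorem actTerm_smul (L : LieSuperalgebra F g) {n : ℕ} (i : Fin (n + 1)) (c : F)
    (f : MultilinearMap F (fun _ : Fin n => g) g) :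
    L.actTerm i (c • f) = c • L.actTerm i f := by
  ext x
  simp [actTerm]

theorem bracketTerm_add (L : LieSuperalgebra F g) {n : ℕ} (j : Fin (n + 1)) (k : Fin n)
    (f₁ f₂ : MultilinearMap F (fun _ : Fin n => g) g) :
    L.bracketTerm j k (f₁ + f₂) = L.bracketTerm j k f₁ + L.bracketTerm j k f₂ := rfl

theorem bracketTerm_smul (L : LieSuperalgebra F g) {n : ℕ} (j : Fin (n + 1)) (k : Fin n) (c : F)
    (f : MultilinearMap F (fun _ : Fin n => g) g) :
    L.bracketTerm j k (c • f) = c • L.bracketTerm j k f := rfl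

/-- The differential `d : Cⁿ(g, g) → Cⁿ⁺¹(g, g)`, given for a cochain `f` of parity `|f|` and
homogeneous `x₀, …, xₙ` by
`(df)(x₀, …, xₙ) = ∑ᵢ (-1)^{i + |xᵢ| (|f| + |x₀| + ⋯ + |xᵢ₋₁|)} [xᵢ, f (x₀, …, x̂ᵢ, …, xₙ)]`
`  + ∑_{i<j} (-1)^{j + |xⱼ| (|xᵢ₊₁| + ⋯ + |xⱼ₋₁|)} f (x₀, …, [xᵢ, xⱼ], …, x̂ⱼ, …, xₙ)`
(in the second sum `i = j.succAbove k`).  The formula is written for all multilinear maps `f`. -/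
noncomputable def d (L : LieSuperalgebra F g) (n : ℕ) :
    MultilinearMap F (fun _ : Fin n => g) g →ₗ[F]
      MultilinearMap F (fun _ : Fin (n + 1) => g) g where
  toFun f := ∑ e : Fin (n + 1) → ZMod 2, L.restrict e
    ((∑ δ : ZMod 2, ∑ i : Fin (n + 1),
        ((-1 : ℤˣ) ^ (i : ℕ) * (-1 : ℤˣ) ^ (e i * (δ + ∑ k ∈ Finset.Iio i, e k))) •
          L.actTerm i (L.parityPart δ f))
      + ∑ j : Fin (n + 1), ∑ k : Fin n,
          if j.succAbove k < j then
            ((-1 : ℤˣ) ^ (j : ℕ) *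
                (-1 : ℤˣ) ^ (e j * ∑ l ∈ Finset.Ioo (j.succAbove k) j, e l)) •
              L.bracketTerm j k f
          else 0)
  map_add' := by
    intro f₁ f₂
    rw [← Finset.sum_add_distrib]
    refine Finset.sum_congr rfl fun e _ => ?_
    rw [← restrict_add]
    congr 1
    rw [add_add_add_comm]
    simp only [← Finset.sum_add_distrib]
    congr 1
    · simp only [parityPart_add, actTerm_add, smul_add]
    · refine Finset.sum_congr rfl fun j _ => Finset.sum_congr rfl fun k _ => ?_
      split_ifs
      · rw [bracketTerm_add, smul_add]
      · rw [add_zero]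
  map_smul' := by
    intro c f
    rw [RingHom.id_apply, Finset.smul_sum]
    refine Finset.sum_congr rfl fun e _ => ?_
    rw [← restrict_smul]
    congr 1
    rw [smul_add]
    simp only [Finset.smul_sum]
    congr 1
    · simp only [parityPart_smul, actTerm_smul]
      refine Finset.sum_congr rfl fun δ _ => Finset.sum_congr rfl fun i _ => ?_
      exact smul_comm _ _ _
    · refine Finset.sum_congr rfl fun j _ => Finset.sum_congr rfl fun k _ => ?_
      split_ifs
      · rw [bracketTerm_smul]
        exact smul_comm _ _ _
      · rw [smul_zero]

/-! ### Cohomology -/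

/-- The space of `n`-cocycles `Zⁿ(g, g)`. -/
noncomputable def cocycles (L : LieSuperalgebra F g) (n : ℕ) :
    Submodule F (MultilinearMap F (fun _ : Fin n => g) g) :=
  L.cochains n ⊓ LinearMap.ker (L.d n)

/-- The space of `n`-coboundaries `Bⁿ(g, g)`. -/
noncomputable def coboundaries (L : LieSuperalgebra F g) :
    (n : ℕ) → Submodule F (MultilinearMap F (fun _ : Fin n => g) g)
  | 0 => ⊥
  | n + 1 => (L.cochains n).map (L.d n)

/-- The adjoint cohomology `Hⁿ(g, g)`: the space of cocycles modulo coboundaries. -/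
abbrev Cohomology (L : LieSuperalgebra F g) (n : ℕ) : Type _ :=
  L.cocycles n ⧸ (L.coboundaries n).submoduleOf (L.cocycles n)

/-- The class in `Hⁿ(g, g)` of a cocycle. -/
noncomputable def cohomologyClass (L : LieSuperalgebra F g) {n : ℕ} (f : L.cocycles n) :
    L.Cohomology n :=
  Submodule.Quotient.mk f

/-! ### The cup product -/

/-- The multilinear map
`(x₀, …, x_{p+q-1}) ↦ [f (x_{σ(0)}, …, x_{σ(p-1)}), h (x_{σ(p)}, …, x_{σ(p+q-1)})]`. -/
noncomputable def shuffleTerm (L : LieSuperalgebra F g) {p q : ℕ} (σ : Equiv.Perm (Fin (p + q)))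
    (f : MultilinearMap F (fun _ : Fin p => g) g) (h : MultilinearMap F (fun _ : Fin q => g) g) :
    MultilinearMap F (fun _ : Fin (p + q) => g) g :=
  (TensorProduct.lift L.bracket).compMultilinearMap
    ((f.domCoprod h).domDomCongr (finSumFinEquiv.trans σ))

theorem shuffleTerm_apply (L : LieSuperalgebra F g) {p q : ℕ} (σ : Equiv.Perm (Fin (p + q)))
    (f : MultilinearMap F (fun _ : Fin p => g) g) (h : MultilinearMap F (fun _ : Fin q => g) g)
    (x : Fin (p + q) → g) :
    L.shuffleTerm σ f h x =
      L.bracket (f fun i => x (σ (Fin.castAdd q i))) (h fun i => x (σ (Fin.natAdd p i))) := rfl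

/-- The cup product of `f ∈ Cᵖ(g, g)` and `h ∈ C^q(g, g)` with respect to the bracket of `g`:
`f ∪ h = (1 / (p! q!)) ∑_σ F_σ(f, h)`, the sum running over all permutations `σ`, where
`F_σ(f, h)(x) = (-1)^{|x'| |h|} ε(σ) γ(x, σ) [f (x'), h (x'')]` for homogeneous
`x = (x₀, …, x_{p+q-1})` and homogeneous `h`, with `x' = (x_{σ(0)}, …, x_{σ(p-1)})` and
`x'' = (x_{σ(p)}, …, x_{σ(p+q-1)})`. -/
noncomputable def cup (L : LieSuperalgebra F g) {p q : ℕ}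
    (f : MultilinearMap F (fun _ : Fin p => g) g) (h : MultilinearMap F (fun _ : Fin q => g) g) :
    MultilinearMap F (fun _ : Fin (p + q) => g) g :=
  (1 / ((p.factorial : F) * (q.factorial : F))) •
    ∑ σ : Equiv.Perm (Fin (p + q)), ∑ e : Fin (p + q) → ZMod 2, ∑ δ : ZMod 2,
      ((-1 : ℤˣ) ^ ((∑ i : Fin p, e (σ (Fin.castAdd q i))) * δ) * permSign e σ) •
        L.restrict e (L.shuffleTerm σ f (L.parityPart δ h))

/-- The cup product on `H^•(g, g) = ⨁ₙ Hⁿ(g, g)` is trivial: for all classes `[f] ∈ Hᵖ(g, g)` and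
`[h] ∈ H^q(g, g)`, the cochain `f ∪ h` is a cocycle and `[f] ∪ [h] = [f ∪ h]` is zero in
`H^{p+q}(g, g)`. -/
def CupProductTrivial (L : LieSuperalgebra F g) : Prop :=
  ∀ (p q : ℕ) (f : L.cocycles p) (h : L.cocycles q),
    ∃ hc : L.cup f.1 h.1 ∈ L.cocycles (p + q), L.cohomologyClass ⟨L.cup f.1 h.1, hc⟩ = 0

/-! ### The two families of Heisenberg Lie superalgebras -/

section Families

variable (F)

theorem zmodTwo_cases (i : ZMod 2) : i = 0 ∨ i = 1 := by
  revert i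
  decide

/-- The bracket of `h_{2m,n}`, as a bilinear map. -/
def heisenbergEvenBracket (m n : ℕ) :
    (F × (Fin m → F) × (Fin m → F) × (Fin n → F)) →ₗ[F]
      (F × (Fin m → F) × (Fin m → F) × (Fin n → F)) →ₗ[F]
        (F × (Fin m → F) × (Fin m → F) × (Fin n → F)) :=
  LinearMap.mk₂ F
    (fun u v => (∑ i, (u.2.1 i * v.2.2.1 i - u.2.2.1 i * v.2.1 i)
      + ∑ j, u.2.2.2 j * v.2.2.2 j, 0, 0, 0))
    (by intro u u' v; ext <;> simp [add_mul, Finset.sum_add_distrib]; ring)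
    (by intro c u v; ext <;> simp [mul_add, mul_sub, mul_assoc, Finset.mul_sum])
    (by intro u v v'; ext <;> simp [mul_add, Finset.sum_add_distrib]; ring)
    (by intro c u v; ext <;> simp [mul_add, mul_sub, mul_left_comm, Finset.mul_sum])

/-- The Lie superalgebra `h_{2m,n}`, with even part of basis `z, x₁, …, x_{2m}` and odd part of
basis `y₁, …, yₙ`, and with `[xᵢ, x_{m+i}] = [yⱼ, yⱼ] = z`, the other brackets of basis elements
(up to skew-supersymmetry) being zero.
The vector `(c, a, b, r)` stands for `c z + ∑ aᵢ xᵢ + ∑ bᵢ x_{m+i} + ∑ rⱼ yⱼ`. -/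
def heisenbergEven (m n : ℕ) :
    LieSuperalgebra F (F × (Fin m → F) × (Fin m → F) × (Fin n → F)) where
  part := fun i => if i = 0 then
      LinearMap.ker (LinearMap.snd F _ _ ∘ₗ LinearMap.snd F _ _ ∘ₗ LinearMap.snd F _ _)
    else LinearMap.ker (LinearMap.fst F _ _) ⊓
      LinearMap.ker (LinearMap.fst F _ _ ∘ₗ LinearMap.snd F _ _) ⊓
      LinearMap.ker (LinearMap.fst F _ _ ∘ₗ LinearMap.snd F _ _ ∘ₗ LinearMap.snd F _ _)
  isInternal := by
    rw [DirectSum.isInternal_submodule_iff_isCompl _ (zero_ne_one : (0 : ZMod 2) ≠ 1)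
      (by ext i; simpa using zmodTwo_cases i)]
    constructor
    · rw [Submodule.disjoint_def]
      rintro ⟨c, a, b, r⟩ h0 h1
      simp_all
    · rw [codisjoint_iff, Submodule.eq_top_iff']
      rintro ⟨c, a, b, r⟩
      refine Submodule.mem_sup.2 ⟨(c, a, b, 0), ?_, (0, 0, 0, r), ?_, ?_⟩ <;> simp
  bracket := heisenbergEvenBracket F m n
  bracket_mem := by
    rintro i j ⟨c, a, b, r⟩ hx ⟨c', a', b', r'⟩ hy
    have hij : (1 : ZMod 2) + 1 = 0 := rfl
    obtain rfl | rfl := zmodTwo_cases i <;> obtain rfl | rfl := zmodTwo_cases j <;>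
      simp_all [heisenbergEvenBracket]
  skew := by
    rintro i j ⟨c, a, b, r⟩ hx ⟨c', a', b', r'⟩ hy
    obtain rfl | rfl := zmodTwo_cases i <;> obtain rfl | rfl := zmodTwo_cases j <;>
      simp_all [heisenbergEvenBracket, mul_comm]
  jacobi := by
    intro i j x _ y _ w
    simp [heisenbergEvenBracket]

/-- The bracket of `ba_n`, as a bilinear map. -/
def heisenbergOddBracket (n : ℕ) :
    (F × (Fin n → F) × (Fin n → F)) →ₗ[F]
      (F × (Fin n → F) × (Fin n → F)) →ₗ[F] (F × (Fin n → F) × (Fin n → F)) :=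
  LinearMap.mk₂ F
    (fun u v => (∑ i, (u.2.1 i * v.2.2 i - u.2.2 i * v.2.1 i), 0, 0))
    (by intro u u' v; ext <;> simp [add_mul, Finset.sum_add_distrib]; ring)
    (by intro c u v; ext <;> simp [mul_sub, mul_assoc, Finset.mul_sum])
    (by intro u v v'; ext <;> simp [mul_add, Finset.sum_add_distrib]; ring)
    (by intro c u v; ext <;> simp [mul_sub, mul_left_comm, Finset.mul_sum])

/-- The Lie superalgebra `ba_n`, with even part of basis `x₁, …, xₙ` and odd part of basis
`z, y₁, …, yₙ`, and with `[xᵢ, yᵢ] = z`, the other brackets of basis elements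
(up to skew-supersymmetry) being zero.
The vector `(c, a, b)` stands for `c z + ∑ aᵢ xᵢ + ∑ bᵢ yᵢ`. -/
def heisenbergOdd (n : ℕ) : LieSuperalgebra F (F × (Fin n → F) × (Fin n → F)) where
  part := fun i => if i = 0 then
      LinearMap.ker (LinearMap.fst F _ _) ⊓
        LinearMap.ker (LinearMap.snd F _ _ ∘ₗ LinearMap.snd F _ _)
    else LinearMap.ker (LinearMap.fst F _ _ ∘ₗ LinearMap.snd F _ _)
  isInternal := by
    rw [DirectSum.isInternal_submodule_iff_isCompl _ (zero_ne_one : (0 : ZMod 2) ≠ 1)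
      (by ext i; simpa using zmodTwo_cases i)]
    constructor
    · rw [Submodule.disjoint_def]
      rintro ⟨c, a, b⟩ h0 h1
      simp_all
    · rw [codisjoint_iff, Submodule.eq_top_iff']
      rintro ⟨c, a, b⟩
      refine Submodule.mem_sup.2 ⟨(0, a, 0), ?_, (c, 0, b), ?_, ?_⟩ <;> simp
  bracket := heisenbergOddBracket F n
  bracket_mem := by
    rintro i j ⟨c, a, b⟩ hx ⟨c', a', b'⟩ hy
    have hij : (1 : ZMod 2) + 1 = 0 := rfl
    obtain rfl | rfl := zmodTwo_cases i <;> obtain rfl | rfl := zmodTwo_cases j <;>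
      simp_all [heisenbergOddBracket]
  skew := by
    rintro i j ⟨c, a, b⟩ hx ⟨c', a', b'⟩ hy
    obtain rfl | rfl := zmodTwo_cases i <;> obtain rfl | rfl := zmodTwo_cases j <;>
      simp_all [heisenbergOddBracket, mul_comm]
  jacobi := by
    intro i j x _ y _ w
    simp [heisenbergOddBracket]

end Families

end LieSuperalgebra

/-!
A Heisenberg Lie superalgebra is `g = V ⊕ F z` with `[x, y] = ω(x, y) z`, where `ω` is
non-degenerate on `V`. The cup product of `f` and `h` only sees their `V`-components and takes
values in `F z`: if `f = ∑ αᵢ ⊗ bᵢ` and `h = ∑ βⱼ ⊗ bⱼ` in a homogeneous basis `b` containing `z`,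
then, up to signs, `f ∪ h = ∑ ω(bᵢ, bⱼ) (αᵢ βⱼ) ⊗ z`. If `f` and `h` are cocycles, the components
`αᵢ`, `βⱼ` along `V` are closed scalar forms. Conversely, if `γₖ` are closed scalar forms, `ξₖ` the
dual basis of `V*` and `v'ₖ ∈ V` the vectors with `ω(·, v'ₖ) = ξₖ`, then
`d (∑ ± γₖ ⊗ v'ₖ) = (∑ ξₖ γₖ) ⊗ z`. Hence it suffices that the product of two closed scalar forms
of positive degree lies in the ideal generated by `V*` in the algebra of closed scalar forms
(`WordForm.HeisenbergData.mul_mem_exactForms`). A cocycle of degree zero is a central element, and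
its cup products vanish.

For the ideal membership, the differential of a scalar form is `ω · ι_z α` up to sign, so it lowers
the degree in `ζ = z*` by exactly one, and the `ζ`-homogeneous components of a closed form are
closed. Let `α`, `β` be closed of `ζ`-degrees `k`, `l`. Euler's identity `m β = ∑ ξₖ · ι_k β`,
where `m` is the degree of `β` in `V*`, gives `α β = (1/m) ∑ ± ξₖ (α · ι_k β)`, and the factors
`α · ι_k β` are closed if `l = 0`, or if `k ≠ 0`, since then `ω α = 0`. For `k = 0` and `l ≠ 0`
Euler's identity is applied to `α` instead. The remaining case is that `β` is a multiple of a power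
of `ζ`; such a form is closed only if it is zero, because `ω ≠ 0`.

Scalar forms are represented by functions on words in the basis, that is, on `List ι`. A form is
determined by its value on the empty word and its contractions with the basis vectors, and the
product is the signed shuffle product, defined so that contractions are twisted derivations of it;
identities between forms are then proved by induction on the word. The normalised sum over all
permutations in the definition of the cup product is identified with the shuffle product in
`WordForm.sum_permSign_mul`.
-/

/-! ### Scalar forms as functions on words, and the signed shuffle product -/

namespace WordForm

variable {ι F : Type*} [Field F]

/-- The contraction of a form with the basis vector `x`, inserted as the first argument. -/
def contract (x : ι) : (List ι → F) →ₗ[F] (List ι → F) where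
  toFun α := fun w => α (x :: w)
  map_add' _ _ := rfl
  map_smul' _ _ := rfl

/-- The form `α` multiplied on each word by the value of the character `χ` of the free monoid. -/
def twist (χ : ι → F) : (List ι → F) →ₗ[F] (List ι → F) where
  toFun α := fun w => (w.map χ).prod * α w
  map_add' _ _ := by ext w; simp [mul_add]
  map_smul' _ _ := by ext w; simp [mul_left_comm]

@[simp] theorem contract_apply (x : ι) (α : List ι → F) (w : List ι) :
    contract x α w = α (x :: w) := rfl

@[simp] theorem twist_apply (χ : ι → F) (α : List ι → F) (w : List ι) :
    twist χ α w = (w.map χ).prod * α w := rfl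

/-- The value at a word of the shuffle product of two forms: the sum over all ways to split the word
into two complementary subwords `u`, `v` of `± α u * β v`, where `c x y` is the sign of an exchange
of the adjacent letters `x` and `y`. In the recursion the first letter `x` either goes to `u`, or it
goes to `v` after having passed all of `u`. -/
def shuffle (c : ι → ι → F) : List ι → (List ι → F) →ₗ[F] (List ι → F) →ₗ[F] F
  | [] => (LinearMap.mul F F).compl₁₂ (LinearMap.proj []) (LinearMap.proj [])
  | x :: w => (shuffle c w).compl₁₂ (contract x) LinearMap.id
      + (shuffle c w).compl₁₂ (twist (c x)) (contract x)

/-- The product of forms. -/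
def mul (c : ι → ι → F) : (List ι → F) →ₗ[F] (List ι → F) →ₗ[F] (List ι → F) :=
  LinearMap.mk₂ F (fun α β w => shuffle c w α β)
    (fun _ _ _ => by ext; simp) (fun _ _ _ => by ext; simp)
    (fun _ _ _ => by ext; simp) (fun _ _ _ => by ext; simp)

variable (c : ι → ι → F)

@[simp] theorem mul_nil (α β : List ι → F) : mul c α β [] = α [] * β [] := rfl

theorem mul_cons (α β : List ι → F) (x : ι) (w : List ι) :
    mul c α β (x :: w)
      = mul c (contract x α) β w + mul c (twist (c x) α) (contract x β) w := rfl

theorem contract_mul (α β : List ι → F) (x : ι) :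
    contract x (mul c α β)
      = mul c (contract x α) β + mul c (twist (c x) α) (contract x β) := rfl

theorem contract_twist (χ : ι → F) (α : List ι → F) (x : ι) :
    contract x (twist χ α) = χ x • twist χ (contract x α) := by
  ext w; simp [mul_assoc]

theorem twist_comm (χ χ' : ι → F) (α : List ι → F) :
    twist χ (twist χ' α) = twist χ' (twist χ α) := by
  ext w; simp [mul_left_comm]

theorem twist_twist (χ χ' : ι → F) (α : List ι → F) :
    twist χ (twist χ' α) = twist (fun y => χ y * χ' y) α := by
  ext w; simp [List.prod_map_mul, mul_assoc]

theorem twist_mul (χ : ι → F) (α β : List ι → F) :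
    twist χ (mul c α β) = mul c (twist χ α) (twist χ β) := by
  ext w
  induction w generalizing α β with
  | nil => simp
  | cons x w ih =>
    have h1 := ih (contract x α) β
    have h2 := ih (twist (c x) α) (contract x β)
    simp only [twist_apply] at h1 h2
    rw [twist_apply, mul_cons, mul_cons, contract_twist, contract_twist, twist_comm (c x) χ]
    simp only [map_smul, LinearMap.smul_apply, Pi.smul_apply, smul_eq_mul, List.map_cons,
      List.prod_cons, ← h1, ← h2]
    ring

theorem mul_assoc' (α β γ : List ι → F) : mul c (mul c α β) γ = mul c α (mul c β γ) := by
  ext w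
  induction w generalizing α β γ with
  | nil => simp [_root_.mul_assoc]
  | cons x w ih =>
    simp only [mul_cons, contract_mul, twist_mul, map_add, LinearMap.add_apply, Pi.add_apply, ih]
    ring

/-- Moving the letter `x` past any word on which `β` does not vanish produces the sign `lam x`. This
holds for forms that are homogeneous in degree and parity. -/
def HasFactor (lam : ι → F) (β : List ι → F) : Prop := ∀ x, twist (c x) β = lam x • β

variable {c}

theorem HasFactor.contract (hsymm : ∀ x y, c x y = c y x) (hsq : ∀ x y, c x y * c x y = 1)
    {lam : ι → F} {β : List ι → F} (h : HasFactor c lam β) (x : ι) :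
    HasFactor c (fun y => c x y * lam y) (contract x β) := by
  intro y
  have h1 := contract_twist (c y) β x
  rw [h y, map_smul] at h1
  have h2 := congrArg (fun φ => c x y • φ) h1
  simp only [smul_smul] at h2
  rw [hsymm y x, hsq, one_smul] at h2
  exact h2.symm

/-- Supercommutativity, for a homogeneous left factor. -/
theorem HasFactor.mul_comm (hsymm : ∀ x y, c x y = c y x) (hsq : ∀ x y, c x y * c x y = 1)
    {lam : ι → F} {β : List ι → F} (h : HasFactor c lam β) (α : List ι → F) :
    mul c β α = mul c (twist lam α) β := by
  ext w
  induction w generalizing α β lam with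
  | nil => simp [_root_.mul_comm]
  | cons x w ih =>
    rw [mul_cons, mul_cons, ih (h.contract hsymm hsq x), h x, contract_twist, twist_twist]
    simp only [map_smul, LinearMap.smul_apply, Pi.smul_apply]
    rw [ih h, add_comm]

variable (c)

/-- Super-alternating forms: exchanging two adjacent letters `x`, `y` multiplies the value by
`c x y`. -/
def IsSuper (α : List ι → F) : Prop :=
  ∀ (u : List ι) (x y : ι) (v : List ι), α (u ++ y :: x :: v) = c x y * α (u ++ x :: y :: v)

variable {c}

theorem IsSuper.contract {α : List ι → F} (h : IsSuper c α) (x : ι) :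
    IsSuper c (contract x α) := fun u a b v => h (x :: u) a b v

theorem IsSuper.contract_comm {α : List ι → F} (h : IsSuper c α) (x y : ι) :
    WordForm.contract x (WordForm.contract y α)
      = c x y • WordForm.contract y (WordForm.contract x α) := by
  ext w; exact h [] x y w

theorem IsSuper.zero : IsSuper c (0 : List ι → F) := fun _ _ _ _ => by simp

theorem IsSuper.add {α β : List ι → F} (hα : IsSuper c α) (hβ : IsSuper c β) :
    IsSuper c (α + β) := fun u x y v => by
  simp only [Pi.add_apply, hα u x y v, hβ u x y v]; ring

theorem IsSuper.smul {α : List ι → F} (hα : IsSuper c α) (a : F) :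
    IsSuper c (a • α) := fun u x y v => by
  simp only [Pi.smul_apply, hα u x y v, smul_eq_mul]; ring

theorem IsSuper.sum {κ : Type*} (s : Finset κ) {α : κ → List ι → F}
    (h : ∀ k ∈ s, IsSuper c (α k)) : IsSuper c (∑ k ∈ s, α k) :=
  Finset.sum_induction _ _ (fun _ _ => IsSuper.add) IsSuper.zero h

theorem IsSuper.mul_perm {α : List ι → F} (hα : IsSuper c α) {φ : List ι → F}
    (hφ : ∀ u v, u.Perm v → φ u = φ v) : IsSuper c (fun w => φ w * α w) := fun u x y v => by
  beta_reduce
  rw [hα u x y v, hφ (u ++ y :: x :: v) (u ++ x :: y :: v)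
    ((List.Perm.swap x y v).append_left u)]
  ring

theorem IsSuper.twist {α : List ι → F} (hα : IsSuper c α) (χ : ι → F) :
    IsSuper c (twist χ α) :=
  hα.mul_perm fun _ _ h => (h.map χ).prod_eq

theorem IsSuper.mul (hsymm : ∀ x y, c x y = c y x) (hsq : ∀ x y, c x y * c x y = 1)
    {α β : List ι → F} (hα : IsSuper c α) (hβ : IsSuper c β) : IsSuper c (mul c α β) := by
  intro u
  induction u generalizing α β with
  | nil =>
    intro x y v
    simp only [List.nil_append, mul_cons, contract_twist, map_smul, LinearMap.smul_apply,
      Pi.smul_apply, smul_eq_mul]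
    rw [hα.contract_comm x y, hβ.contract_comm x y, twist_comm (c x), hsymm y x]
    simp only [map_smul, LinearMap.smul_apply, Pi.smul_apply, smul_eq_mul]
    linear_combination (-WordForm.mul c (WordForm.twist (c x) (WordForm.contract y α)) (WordForm.contract x β) v) *
      hsq x y
  | cons a u ih =>
    intro x y v
    simp only [List.cons_append, mul_cons]
    rw [ih (hα.contract a) hβ, ih (hα.twist _) (hβ.contract a)]
    ring

/-! ### Gradings of the space of forms -/

/-- `α` is homogeneous of degree `a` for the grading in which the letter `x` has weight `wt x`. The
weights lie in the field, so that contractions lower degrees by an honest subtraction and Euler's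
identity needs no casts. -/
def IsHom (wt : ι → F) (a : F) (α : List ι → F) : Prop :=
  ∀ w, α w ≠ 0 → (w.map wt).sum = a

theorem IsHom.contract {wt : ι → F} {a : F} {α : List ι → F} (h : IsHom wt a α) (x : ι) :
    IsHom wt (a - wt x) (contract x α) := fun w hw => by
  have := h (x :: w) hw
  simp only [List.map_cons, List.sum_cons] at this
  rw [← this]; ring

theorem IsHom.twist {wt : ι → F} {a : F} {α : List ι → F} (h : IsHom wt a α) (χ : ι → F) :
    IsHom wt a (twist χ α) := fun w hw => h w (right_ne_zero_of_mul hw)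

theorem IsHom.zero {wt : ι → F} {a : F} : IsHom wt a 0 := fun _ h => absurd rfl h

theorem IsHom.smul {wt : ι → F} {a : F} {α : List ι → F} (h : IsHom wt a α) (t : F) :
    IsHom wt a (t • α) := fun w hw => h w (right_ne_zero_of_mul hw)

theorem IsHom.add {wt : ι → F} {a : F} {α β : List ι → F} (hα : IsHom wt a α)
    (hβ : IsHom wt a β) : IsHom wt a (α + β) := fun w hw => by
  by_contra h
  have h1 : α w = 0 := by by_contra h'; exact h (hα w h')
  have h2 : β w = 0 := by by_contra h'; exact h (hβ w h')
  exact hw (by simp [h1, h2])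

theorem IsHom.sum {κ : Type*} {wt : ι → F} {a : F} (s : Finset κ) {α : κ → List ι → F}
    (h : ∀ k ∈ s, IsHom wt a (α k)) : IsHom wt a (∑ k ∈ s, α k) :=
  Finset.sum_induction _ _ (fun _ _ => IsHom.add) IsHom.zero h

theorem IsHom.mul {wt : ι → F} {a b : F} {α β : List ι → F} (hα : IsHom wt a α)
    (hβ : IsHom wt b β) : IsHom wt (a + b) (mul c α β) := by
  intro w
  induction w generalizing α β a b with
  | nil =>
    intro h
    rw [mul_nil] at h
    rw [← hα _ (left_ne_zero_of_mul h), ← hβ _ (right_ne_zero_of_mul h)]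
    simp
  | cons x w ih =>
    intro h
    rw [mul_cons] at h
    rw [List.map_cons, List.sum_cons]
    by_cases h1 : WordForm.mul c (WordForm.contract x α) β w = 0
    · rw [h1, zero_add] at h
      rw [ih (hα.twist _) (hβ.contract x) h]; ring
    · rw [ih (hα.contract x) hβ h1]; ring

open Classical in
/-- The homogeneous component of degree `a` of a form. -/
noncomputable def part (wt : ι → F) (a : F) (α : List ι → F) : List ι → F :=
  fun w => if (w.map wt).sum = a then α w else 0

theorem part_isHom (wt : ι → F) (a : F) (α : List ι → F) : IsHom wt a (part wt a α) := by
  intro w hw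
  by_contra h
  exact hw (if_neg h)

theorem IsHom.part {wt wt' : ι → F} {a b : F} {α : List ι → F} (h : IsHom wt a α) :
    IsHom wt a (part wt' b α) := by
  intro w hw
  unfold WordForm.part at hw
  exact h w fun h0 => hw (by simp [h0])

theorem contract_part (wt : ι → F) (a : F) (α : List ι → F) (x : ι) :
    contract x (part wt a α) = part wt (a - wt x) (contract x α) := by
  ext w
  have h : ((x :: w).map wt).sum = a ↔ (w.map wt).sum = a - wt x := by
    simp [eq_sub_iff_add_eq']
  unfold part
  rw [contract_apply]
  split_ifs with h1 h2 h2
  · rfl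
  · exact absurd (h.1 h1) h2
  · exact absurd (h.2 h2) h1
  · rfl

theorem IsSuper.part {α : List ι → F} (hα : IsSuper c α) (wt : ι → F) (a : F) :
    IsSuper c (part wt a α) := by
  classical
  have h := hα.mul_perm (φ := fun w => if (w.map wt).sum = a then 1 else 0) (by
    intro u v huv; simp only [(huv.map wt).sum_eq])
  convert h using 1
  ext w
  simp [WordForm.part]

theorem IsHom.mul_part {wt : ι → F} {a b : F} {α : List ι → F} (hα : IsHom wt a α)
    (β : List ι → F) : WordForm.mul c α (WordForm.part wt b β)
      = WordForm.part wt (a + b) (WordForm.mul c α β) := by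
  ext w
  induction w generalizing α β a b with
  | nil =>
    by_cases h : α [] = 0
    · simp [WordForm.part, h]
    · have := hα _ h
      simp only [List.map_nil, List.sum_nil] at this
      rw [mul_nil, ← this, zero_add]
      unfold WordForm.part
      split_ifs <;> simp
  | cons x w ih =>
    rw [mul_cons, contract_part, ih (hα.contract x), ih (hα.twist _)]
    have h1 := congrFun (contract_part wt (a + b) (WordForm.mul c α β) x) w
    rw [contract_apply] at h1
    rw [h1, contract_mul]
    simp only [WordForm.part, Pi.add_apply]
    rw [show a - wt x + b = a + b - wt x by ring, show a + (b - wt x) = a + b - wt x by ring]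
    split_ifs <;> simp

/-! ### The dual basis and Euler's identity -/

/-- The form of degree zero with value `1`, the unit of the shuffle product. -/
def unit : List ι → F := fun w => if w = [] then 1 else 0

theorem contract_unit (x : ι) : contract x (unit : List ι → F) = 0 := by
  ext w; simp [unit]

theorem twist_unit (χ : ι → F) : twist χ (unit : List ι → F) = unit := by
  ext w; simp only [unit, twist_apply]; split_ifs with h <;> simp [h]

theorem unit_mul (β : List ι → F) : mul c unit β = β := by
  ext w
  induction w generalizing β with
  | nil => simp [unit]
  | cons x w ih => rw [mul_cons, contract_unit, twist_unit, ih]; simp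

variable [DecidableEq ι]

/-- The one-form dual to the basis vector `k`. -/
def dual (k : ι) : List ι → F := fun w => if w = [k] then 1 else 0

theorem contract_dual (x k : ι) :
    contract x (dual k : List ι → F) = if x = k then unit else 0 := by
  ext w
  by_cases h : x = k <;> simp [dual, unit, h]

theorem twist_dual (χ : ι → F) (k : ι) : twist χ (dual k : List ι → F) = χ k • dual k := by
  ext w; simp only [dual, twist_apply, Pi.smul_apply]; split_ifs with h <;> simp [h]

theorem dual_hasFactor (k : ι) : HasFactor c (fun x => c x k) (dual k) :=
  fun x => twist_dual (c x) k

variable [Fintype ι]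

theorem sum_dual_mul_cons (B : ι → List ι → F) (x : ι) (w : List ι) :
    (∑ k, mul c (dual k) (B k)) (x :: w)
      = B x w + (∑ k, mul c (dual k) (c x k • contract x (B k))) w := by
  rw [Finset.sum_apply, Finset.sum_apply]
  simp only [mul_cons, contract_dual, twist_dual, Finset.sum_add_distrib]
  congr 1
  · rw [Finset.sum_eq_single x]
    · simp [unit_mul]
    · intro k _ hk; simp [hk.symm]
    · simp
  · simp

/-- Euler's identity: the weighted sum of the operators `ξₖ · ι_k` is multiplication by the
degree. -/
theorem IsSuper.euler (hsq : ∀ x y, c x y * c x y = 1)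
    {wt : ι → F} {a : F} {α : List ι → F} (hs : IsSuper c α) (h : IsHom wt a α) :
    ∑ k, WordForm.mul c (dual k) (wt k • WordForm.contract k α) = a • α := by
  ext w
  induction w generalizing α a with
  | nil =>
    rw [Finset.sum_apply]
    by_cases h0 : α [] = 0
    · simp [dual, h0]
    · have := h _ h0
      simp only [List.map_nil, List.sum_nil] at this
      simp [dual, ← this]
  | cons x w ih =>
    rw [sum_dual_mul_cons]
    have : ∀ k, c x k • WordForm.contract x (wt k • WordForm.contract k α)
        = wt k • WordForm.contract k (WordForm.contract x α) := by
      intro k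
      rw [map_smul, hs.contract_comm x k, smul_comm, smul_smul, smul_smul, _root_.mul_assoc,
        hsq, mul_one]
    simp only [this, ih (hs.contract x) (h.contract x)]
    simp; ring

end WordForm

/-! ### Closed forms and the ideal generated by one-forms -/

namespace WordForm

variable {ι F : Type*} [Field F]

/-- The two-form with coefficients `Ω`. -/
def twoForm (Ω : ι → ι → F) : List ι → F
  | [x, y] => Ω x y
  | _ => 0

/-- The combinatorial data of a Heisenberg Lie superalgebra in a homogeneous basis: the exchange
signs `c`, the letter `star` of the central element, and the matrix `Ω` of the bracket. The field
`degree` expresses that the bracket of the basis vectors `x`, `y` has the parity of the central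
element, so that passing `x` and `y` amounts to passing `star`, up to the sign that accounts for
the one letter less. -/
structure HeisenbergData (c : ι → ι → F) (star : ι) (Ω : ι → ι → F) : Prop where
  symm : ∀ x y, c x y = c y x
  sq : ∀ x y, c x y * c x y = 1
  left : ∀ x, Ω star x = 0
  right : ∀ x, Ω x star = 0
  degree : ∀ x y, Ω x y ≠ 0 → ∀ k, c k x * c k y = - c k star
  nonzero : ∃ x y, Ω x y ≠ 0

/-- The closed scalar forms of degree `a`. The differential of a super-alternating scalar form `α` is
`-ω · ι_star α`, where `ω` is the two-form of the bracket. -/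
def closedForms (c : ι → ι → F) (star : ι) (Ω : ι → ι → F) (a : F) :
    Submodule F (List ι → F) where
  carrier := {α | IsSuper c α ∧ IsHom (fun _ => 1) a α ∧
    mul c (twoForm Ω) (contract star α) = 0}
  zero_mem' := ⟨IsSuper.zero, IsHom.zero, by simp⟩
  add_mem' h h' := ⟨h.1.add h'.1, h.2.1.add h'.2.1, by
    rw [map_add, map_add, h.2.2, h'.2.2, add_zero]⟩
  smul_mem' t _ h := ⟨h.1.smul t, h.2.1.smul t, by rw [map_smul, map_smul, h.2.2, smul_zero]⟩

theorem IsHom.sub {wt wt' : ι → F} {a b : F} {α : List ι → F} (h : IsHom wt a α)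
    (h' : IsHom wt' b α) : IsHom (fun x => wt x - wt' x) (a - b) α := by
  intro w hw
  rw [← h w hw, ← h' w hw]
  clear hw
  induction w with
  | nil => simp
  | cons x w ih => simp only [List.map_cons, List.sum_cons, ih]; ring

theorem sum_map_natCast (n : ι → ℕ) (w : List ι) :
    (w.map fun x => (n x : F)).sum = ((w.map n).sum : ℕ) := by
  induction w with
  | nil => simp
  | cons x w ih => simp [ih]

theorem IsHom.contract_eq_zero [CharZero F] {n : ι → ℕ} {α : List ι → F}
    (h : IsHom (fun y => (n y : F)) 0 α) {x : ι} (hx : n x ≠ 0) : WordForm.contract x α = 0 := by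
  ext w
  by_contra h0
  have h1 := h (x :: w) h0
  rw [sum_map_natCast, Nat.cast_eq_zero] at h1
  simp at h1
  exact hx h1.1

theorem twist_twoForm {Ω : ι → ι → F} {χ : ι → F} {μ : F}
    (h : ∀ x y, Ω x y ≠ 0 → χ x * χ y = μ) : twist χ (twoForm Ω) = μ • twoForm Ω := by
  ext w
  rcases w with _ | ⟨x, _ | ⟨y, _ | ⟨_, _⟩⟩⟩
  · simp [twoForm]
  · simp [twoForm]
  · by_cases h0 : Ω x y = 0
    · simp [twoForm, h0]
    · simp [twoForm, ← h x y h0]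
  · simp [twoForm]

variable {c : ι → ι → F} {star : ι} {Ω : ι → ι → F}

theorem HeisenbergData.hasFactor (H : HeisenbergData c star Ω) :
    HasFactor c (fun x => - c x star) (twoForm Ω) :=
  fun k => twist_twoForm fun x y h => H.degree x y h k

/-- A twist that multiplies `ω` by a non-zero scalar preserves closed forms. -/
theorem twist_mem_closedForms {χ : ι → F} {μ : F} (hμ : μ ≠ 0)
    (h : ∀ x y, Ω x y ≠ 0 → χ x * χ y = μ) {a : F} {α : List ι → F}
    (hα : α ∈ closedForms c star Ω a) : twist χ α ∈ closedForms c star Ω a := by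
  refine ⟨hα.1.twist χ, hα.2.1.twist χ, ?_⟩
  have h1 := congrArg (twist χ) hα.2.2
  rw [map_zero, twist_mul, twist_twoForm h, map_smul, LinearMap.smul_apply,
    smul_eq_zero_iff_right hμ] at h1
  rw [contract_twist, map_smul, h1, smul_zero]

theorem HeisenbergData.ne_zero (H : HeisenbergData c star Ω) (x y : ι) : c x y ≠ 0 := fun h => by
  simpa [h] using H.sq x y

theorem HeisenbergData.twist_mem (H : HeisenbergData c star Ω) (k : ι) {a : F} {α : List ι → F}
    (hα : α ∈ closedForms c star Ω a) :
    twist (fun x => c x k) α ∈ closedForms c star Ω a :=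
  twist_mem_closedForms (neg_ne_zero.2 (H.ne_zero k star))
    (fun x y h => by rw [H.symm x, H.symm y, H.degree x y h k]) hα

theorem HeisenbergData.twist_twist_self (H : HeisenbergData c star Ω) (k : ι) (α : List ι → F) :
    twist (fun x => c x k) (twist (fun x => c x k) α) = α := by
  rw [twist_twist]
  ext w
  simp [H.sq]

theorem isHom_twoForm {wt : ι → F} {a : F} (h : ∀ x y, Ω x y ≠ 0 → wt x + wt y = a) :
    IsHom wt a (twoForm Ω) := by
  intro w hw
  rcases w with _ | ⟨x, _ | ⟨y, _ | ⟨_, _⟩⟩⟩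
  · simp [twoForm] at hw
  · simp [twoForm] at hw
  · simpa using h x y hw
  · simp [twoForm] at hw

theorem IsHom.contract_one {a : F} {α : List ι → F} (h : IsHom (fun _ => 1) a α) (x : ι) :
    IsHom (fun _ => 1) (a - 1) (WordForm.contract x α) := IsHom.contract h x

section DecEq
variable [DecidableEq ι]

/-- The weight of the grading by the number of letters `star`. -/
def starWt (F : Type*) [Field F] (star : ι) (x : ι) : F := ((if x = star then 1 else 0 : ℕ) : F)

/-- The weight of the grading by the number of letters other than `star`. -/
def vecWt (F : Type*) [Field F] (star : ι) (x : ι) : F := ((if x = star then 0 else 1 : ℕ) : F)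

theorem IsHom.vecWt_of_starWt {p k : F} {α : List ι → F} (h : IsHom (fun _ => 1) p α)
    (h' : IsHom (starWt F star) k α) : IsHom (vecWt F star) (p - k) α := by
  convert h.sub h' using 2 with x
  by_cases hx : x = star <;> simp [starWt, vecWt, hx]

/-- The differential is homogeneous for the grading by the number of letters `star`, so the
homogeneous components of a closed form are closed. -/
theorem HeisenbergData.part_mem (H : HeisenbergData c star Ω) (k : F) {a : F} {α : List ι → F}
    (hα : α ∈ closedForms c star Ω a) :
    part (starWt F star) k α ∈ closedForms c star Ω a := by
  refine ⟨hα.1.part _ _, hα.2.1.part, ?_⟩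
  have h0 : IsHom (starWt F star) 0 (twoForm Ω) := isHom_twoForm fun x y h => by
    have hx : x ≠ star := by rintro rfl; exact h (H.left y)
    have hy : y ≠ star := by rintro rfl; exact h (H.right x)
    simp [starWt, hx, hy]
  rw [contract_part, h0.mul_part, hα.2.2]
  ext w
  simp [part]

theorem sum_part [CharZero F] (star : ι) {p : ℕ} {α : List ι → F}
    (h : IsHom (fun _ => 1) (p : F) α) :
    ∑ k ∈ Finset.range (p + 1), part (starWt F star) (k : F) α = α := by
  ext w
  rw [Finset.sum_apply]
  by_cases h0 : α w = 0
  · simp [part, h0]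
  · have h1 := h w h0
    simp only [List.map_const', List.sum_replicate, nsmul_eq_mul, mul_one, Nat.cast_inj] at h1
    have h2 : (w.map (starWt F star)).sum = (w.count star : ℕ) := by
      unfold starWt
      rw [sum_map_natCast]
      congr 1
      clear h0 h1
      induction w with
      | nil => simp
      | cons x w ih => simp [List.count_cons, ih, add_comm]
    rw [Finset.sum_eq_single (w.count star)]
    · simp [part, h2]
    · intro k _ hk
      unfold part
      rw [if_neg]
      rw [h2, Nat.cast_inj]
      exact hk.symm
    · intro h3
      exact absurd (Finset.mem_range.2 (Nat.lt_succ_of_le (h1 ▸ List.count_le_length))) h3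

/-- A closed form of positive degree supported on the powers of the letter `star` is zero. -/
theorem HeisenbergData.eq_zero_of_vecWt [CharZero F] (H : HeisenbergData c star Ω)
    {q : F} (hq : q ≠ 0) {β : List ι → F}
    (hβ : β ∈ closedForms c star Ω q) (hβ0 : IsHom (vecWt F star) 0 β) : β = 0 := by
  have h0 : ∀ x, x ≠ star → contract x β = 0 := fun x hx =>
    hβ0.contract_eq_zero (by simp [hx])
  obtain ⟨x, y, hxy⟩ := H.nonzero
  have hx : x ≠ star := by rintro rfl; exact hxy (H.left y)
  have hy : y ≠ star := by rintro rfl; exact hxy (H.right x)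
  ext w
  rcases w with _ | ⟨a, w⟩
  · by_contra h1
    exact hq (by simpa using (hβ.2.1 _ h1).symm)
  · by_cases ha : a = star
    · subst ha
      -- On the word `x y w` with `Ω x y ≠ 0`, only one term of `ω · ι_star β` survives.
      have h1 := congrFun hβ.2.2 (x :: y :: w)
      rw [mul_cons, mul_cons, hβ.1.contract_comm x, h0 x hx, hβ.1.contract_comm y, h0 y hy] at h1
      have h2 : contract y (contract x (twoForm Ω)) = Ω x y • (unit : List ι → F) := by
        ext v; rcases v with _ | ⟨_, _⟩ <;> simp [twoForm, unit]
      rw [h2, map_smul] at h1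
      simp only [LinearMap.smul_apply, unit_mul, map_zero, smul_zero, Pi.zero_apply,
        add_zero, Pi.smul_apply, contract_apply, smul_eq_mul] at h1
      exact (mul_eq_zero.1 h1).resolve_left hxy
    · exact congrFun (h0 a ha) w

variable [Fintype ι]

theorem contract_twoForm (x : ι) :
    contract x (twoForm Ω) = ∑ y, Ω x y • dual y := by
  ext w
  rw [Finset.sum_apply]
  rcases w with _ | ⟨y, _ | ⟨_, _⟩⟩
  · simp [twoForm, dual]
  · simp [twoForm, dual]
  · simp [twoForm, dual]

/-- The forms `∑ ξₖ γₖ` with `k ≠ star` and closed `γₖ` of degree `a`; so the degree of such a form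
is `a + 1`. The multiples of the central element by these forms are coboundaries. -/
def exactForms (c : ι → ι → F) (star : ι) (Ω : ι → ι → F) (a : F) : Submodule F (List ι → F) where
  carrier := {φ | ∃ γ : ι → List ι → F, (∀ k, γ k ∈ closedForms c star Ω a) ∧ γ star = 0 ∧
    φ = ∑ k, mul c (dual k) (γ k)}
  zero_mem' := ⟨0, fun _ => zero_mem _, rfl, by simp⟩
  add_mem' := by
    rintro _ _ ⟨γ, h1, h2, rfl⟩ ⟨γ', h1', h2', rfl⟩
    exact ⟨γ + γ', fun k => add_mem (h1 k) (h1' k), by simp [h2, h2'],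
      by simp [Finset.sum_add_distrib]⟩
  smul_mem' := by
    rintro t _ ⟨γ, h1, h2, rfl⟩
    exact ⟨t • γ, fun k => Submodule.smul_mem _ t (h1 k), by simp [h2],
      by simp [Finset.smul_sum]⟩

theorem HeisenbergData.exact_closed (H : HeisenbergData c star Ω) {a : F} {φ : List ι → F}
    (h : φ ∈ exactForms c star Ω a) : mul c (twoForm Ω) (contract star φ) = 0 := by
  obtain ⟨γ, h1, h2, rfl⟩ := h
  rw [map_sum, map_sum]
  refine Finset.sum_eq_zero fun k _ => ?_
  rw [contract_mul, contract_dual, twist_dual]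
  split_ifs with hk
  · subst hk; simp [h2]
  · rw [map_zero, LinearMap.zero_apply, zero_add, ← mul_assoc', H.hasFactor.mul_comm H.symm H.sq,
      map_smul, twist_dual]
    simp only [map_smul, LinearMap.smul_apply]
    rw [mul_assoc', (h1 k).2.2]
    simp

/-- If `α` is closed and contains the letter `star`, then `ω α = 0`: by Euler's identity `α` is a
multiple of `ζ · ι_star α`. -/
theorem HeisenbergData.twoForm_mul (H : HeisenbergData c star Ω) {a k : F}
    (hk : k ≠ 0) {α : List ι → F} (hα : α ∈ closedForms c star Ω a)
    (hw : IsHom (starWt F star) k α) : mul c (twoForm Ω) α = 0 := by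
  have h := hα.1.euler H.sq hw
  rw [Finset.sum_eq_single star (fun x _ hx => by simp [starWt, hx]) (by simp)] at h
  have h' := congrArg (mul c (twoForm Ω)) h
  rw [← mul_assoc', H.hasFactor.mul_comm H.symm H.sq, twist_dual] at h'
  simp only [map_smul, LinearMap.smul_apply] at h'
  rw [mul_assoc', hα.2.2, map_zero, smul_zero, smul_zero] at h'
  exact ((smul_eq_zero_iff_right hk).1 h'.symm)

/-- The case in which Euler's identity is applied to the right factor. The twist of `α` is the sign
for moving the one-form `ξₓ` past `α`. -/
theorem HeisenbergData.mul_mem_exactForms_of_right [CharZero F] (H : HeisenbergData c star Ω)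
    {p q k l m : F} {α β : List ι → F} (hα : α ∈ closedForms c star Ω p)
    (hβ : β ∈ closedForms c star Ω q) (hαk : IsHom (starWt F star) k α)
    (hβl : IsHom (starWt F star) l β) (hkl : l = 0 ∨ k ≠ 0)
    (hβm : IsHom (vecWt F star) m β) (hm : m ≠ 0) :
    mul c α β ∈ exactForms c star Ω (p + q - 1) := by
  refine ⟨fun x => (vecWt F star x * m⁻¹) • mul c (twist (fun y => c y x) α) (contract x β),
    fun x => Submodule.smul_mem _ _ ⟨?_, ?_, ?_⟩, by simp [vecWt], ?_⟩
  · exact (hα.1.twist _).mul H.symm H.sq (hβ.1.contract x)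
  · rw [add_sub_assoc]
    exact (hα.2.1.twist _).mul (hβ.2.1.contract x)
  · rw [contract_mul, map_add, ← mul_assoc', (H.twist_mem x hα).2.2, map_zero,
      LinearMap.zero_apply, zero_add]
    rcases hkl with rfl | hk
    · rw [hβ.1.contract_comm, hβl.contract_eq_zero (x := star) (by simp)]
      simp
    · have h1 : twist (c star) (twist (fun y => c y x) α) ∈ closedForms c star Ω p := by
        have := H.twist_mem star (H.twist_mem x hα)
        rwa [show (fun x => c x star) = c star from funext fun y => H.symm y star] at this
      rw [← mul_assoc', H.twoForm_mul hk h1 ((hαk.twist _).twist _)]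
      simp
  · have h := congrArg (fun φ => m⁻¹ • mul c α φ) (hβ.1.euler H.sq hβm)
    simp only [map_smul, smul_smul, inv_mul_cancel₀ hm, one_smul] at h
    rw [← h, map_sum, Finset.smul_sum]
    refine Finset.sum_congr rfl fun x _ => ?_
    rw [map_smul, map_smul, ← mul_assoc', ← mul_assoc',
      (dual_hasFactor x).mul_comm H.symm H.sq (twist _ α), H.twist_twist_self, smul_smul, mul_comm]

/-- The case in which Euler's identity is applied to the left factor. -/
theorem HeisenbergData.mul_mem_exactForms_of_left [CharZero F] (H : HeisenbergData c star Ω)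
    {p q m : F} {α β : List ι → F} (hα : α ∈ closedForms c star Ω p)
    (hβ : β ∈ closedForms c star Ω q) (hα0 : IsHom (starWt F star) 0 α)
    (hαm : IsHom (vecWt F star) m α) (hm : m ≠ 0) :
    mul c α β ∈ exactForms c star Ω (p + q - 1) := by
  refine ⟨fun x => (vecWt F star x * m⁻¹) • mul c (contract x α) β,
    fun x => Submodule.smul_mem _ _ ⟨?_, ?_, ?_⟩, by simp [vecWt], ?_⟩
  · exact (hα.1.contract x).mul H.symm H.sq hβ.1
  · rw [show p + q - 1 = p - 1 + q by ring]
    exact (hα.2.1.contract_one x).mul hβ.2.1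
  · rw [contract_mul, hα.1.contract_comm, hα0.contract_eq_zero (x := star) (by simp)]
    rw [map_zero, smul_zero, map_zero, LinearMap.zero_apply, zero_add, ← mul_assoc',
      H.hasFactor.mul_comm H.symm H.sq, mul_assoc', hβ.2.2, map_zero]
  · have h := congrArg (fun φ => m⁻¹ • mul c φ β) (hα.1.euler H.sq hαm)
    simp only [map_smul, LinearMap.smul_apply, smul_smul, inv_mul_cancel₀ hm, one_smul] at h
    rw [← h, map_sum, LinearMap.sum_apply, Finset.smul_sum]
    refine Finset.sum_congr rfl fun x _ => ?_
    rw [map_smul, map_smul, LinearMap.smul_apply, mul_assoc', smul_smul, mul_comm]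

/-- Products of closed forms of positive degree lie in the ideal generated by the one-forms. -/
theorem HeisenbergData.mul_mem_exactForms [CharZero F] (H : HeisenbergData c star Ω)
    {p q : ℕ} (hp : p ≠ 0) (hq : q ≠ 0) {α β : List ι → F}
    (hα : α ∈ closedForms c star Ω p) (hβ : β ∈ closedForms c star Ω q) :
    mul c α β ∈ exactForms c star Ω (p + q - 1) := by
  rw [← sum_part star hα.2.1, ← sum_part star hβ.2.1, map_sum]
  refine sum_mem fun l _ => ?_
  rw [map_sum, LinearMap.sum_apply]
  refine sum_mem fun k _ => ?_
  have hα' := H.part_mem (k : F) hα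
  have hβ' := H.part_mem (l : F) hβ
  have hk := part_isHom (starWt F star) (k : F) α
  have hl := part_isHom (starWt F star) (l : F) β
  by_cases h : (l : F) = 0 ∨ (k : F) ≠ 0
  · by_cases hm : (q : F) - l = 0
    · rw [H.eq_zero_of_vecWt (Nat.cast_ne_zero.2 hq) hβ' (hm ▸ hβ'.2.1.vecWt_of_starWt hl),
        map_zero]
      exact zero_mem _
    · exact H.mul_mem_exactForms_of_right hα' hβ' hk hl h (hβ'.2.1.vecWt_of_starWt hl) hm
  · push Not at h
    rw [h.2] at hk hα' ⊢
    refine H.mul_mem_exactForms_of_left hα' hβ' hk (hα'.2.1.vecWt_of_starWt hk) ?_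
    simpa using hp

end DecEq
end WordForm

/-! ### Signs -/

namespace WordForm

open LieSuperalgebra (permSign)

/-- A sign as an element of the field. -/
def sgn (F : Type*) [Field F] : ℤˣ →* F :=
  (Int.castRingHom F).toMonoidHom.comp (Units.coeHom ℤ)

theorem units_smul_eq (F : Type*) [Field F] {V : Type*} [AddCommGroup V] [Module F V]
    (u : ℤˣ) (v : V) : u • v = sgn F u • v := by
  rw [Units.smul_def, ← Int.cast_smul_eq_zsmul F]; rfl

theorem sgn_mul_self (F : Type*) [Field F] (u : ℤˣ) : sgn F u * sgn F u = 1 := by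
  rw [← map_mul, Int.units_mul_self, map_one]

theorem sgn_neg (F : Type*) [Field F] (u : ℤˣ) : sgn F (-u) = - sgn F u := by
  simp [sgn]

/-- The sign `-(-1)^{|x||y|}` of an exchange of adjacent letters, where `e` is the parity. -/
def superSign {ι : Type*} (e : ι → ZMod 2) (x y : ι) : ℤˣ := -(-1 : ℤˣ) ^ (e x * e y)

theorem superSign_comm {ι : Type*} (e : ι → ZMod 2) (x y : ι) :
    superSign e x y = superSign e y x := by rw [superSign, mul_comm, superSign]

/-- The sign for moving the `i`-th letter of a word to the front, where `e` lists the parities of the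
letters. -/
def moveSign {n : ℕ} (e : Fin n → ZMod 2) (i : Fin n) : ℤˣ :=
  (-1 : ℤˣ) ^ (i : ℕ) * (-1 : ℤˣ) ^ (e i * ∑ k ∈ Finset.Iio i, e k)

theorem sum_Iio_eq {M : Type*} [AddCommMonoid M] {n : ℕ} (f : Fin n → M) (i : Fin n) :
    ∑ k ∈ Finset.Iio i, f k = ∑ k, if k < i then f k else 0 := by
  rw [← Finset.sum_filter]; congr 1; ext; simp

theorem sum_Ioo_eq {M : Type*} [AddCommMonoid M] {n : ℕ} (f : Fin n → M) (i j : Fin n) :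
    ∑ k ∈ Finset.Ioo i j, f k = ∑ k, if i < k ∧ k < j then f k else 0 := by
  rw [← Finset.sum_filter]; congr 1; ext; simp

theorem moveSign_zero {n : ℕ} (e : Fin (n + 1) → ZMod 2) : moveSign e 0 = 1 := by
  simp [moveSign, sum_Iio_eq]

theorem moveSign_succ {n : ℕ} (e : Fin (n + 1) → ZMod 2) (j : Fin n) :
    moveSign e j.succ = superSign e j.succ 0 * moveSign (fun k => e k.succ) j := by
  simp only [moveSign, superSign, sum_Iio_eq, Fin.sum_univ_succ, Fin.succ_pos, if_true,
    Fin.succ_lt_succ_iff, mul_add, uzpow_add, Fin.val_succ, pow_succ]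
  simp [mul_comm, mul_left_comm]

theorem prod_uzpow_mul {κ : Type*} (S : Finset κ) (a : ZMod 2) (e : κ → ZMod 2) :
    ∏ i ∈ S, (-1 : ℤˣ) ^ (a * e i) = (-1 : ℤˣ) ^ (a * ∑ i ∈ S, e i) := by
  classical
  induction S using Finset.induction_on with
  | empty => simp
  | insert i S hi ih => rw [Finset.prod_insert hi, Finset.sum_insert hi, ih, mul_add, uzpow_add]

theorem prod_superSign_eq_moveSign {n : ℕ} (e : Fin n → ZMod 2) (i : Fin n) :
    ∏ k ∈ Finset.Iio i, superSign e i k = moveSign e i := by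
  simp only [superSign, Finset.prod_neg, Fin.card_Iio, prod_uzpow_mul, moveSign]

/-! ### Permutations -/

/-- The permutation that sends `0` to `i` and is given by `τ` between the complements of `0` and
`i`. -/
def consPerm {n : ℕ} (i : Fin (n + 1)) (τ : Equiv.Perm (Fin n)) : Equiv.Perm (Fin (n + 1)) :=
  (Equiv.Perm.decomposeFin.symm (0, τ)).trans i.cycleRange.symm

@[simp] theorem consPerm_zero {n : ℕ} (i : Fin (n + 1)) (τ : Equiv.Perm (Fin n)) :
    consPerm i τ 0 = i := by simp [consPerm]

@[simp] theorem consPerm_succ {n : ℕ} (i : Fin (n + 1)) (τ : Equiv.Perm (Fin n)) (j : Fin n) :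
    consPerm i τ j.succ = i.succAbove (τ j) := by simp [consPerm]

theorem consPerm_bijective (n : ℕ) :
    Function.Bijective fun x : Fin (n + 1) × Equiv.Perm (Fin n) => consPerm x.1 x.2 := by
  rw [Fintype.bijective_iff_injective_and_card]
  constructor
  · rintro ⟨i, τ⟩ ⟨i', τ'⟩ h
    have h0 := congrArg (fun σ => σ 0) h
    simp only [consPerm_zero] at h0
    subst h0
    congr 1
    ext j
    have h1 := congrArg (fun σ => σ j.succ) h
    simp only [consPerm_succ] at h1
    rw [Fin.succAbove_right_injective h1]
  · simp [Fintype.card_perm, Nat.factorial_succ]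

theorem sum_perm_succ {M : Type*} [AddCommMonoid M] {n : ℕ} (f : Equiv.Perm (Fin (n + 1)) → M) :
    ∑ σ, f σ = ∑ i, ∑ τ, f (consPerm i τ) := by
  rw [← Fintype.sum_prod_type']
  exact ((consPerm_bijective n).sum_comp f).symm

theorem permSign_eq_prod {n : ℕ} (e : Fin n → ZMod 2) (σ : Equiv.Perm (Fin n)) :
    permSign e σ = ∏ i, ∏ j, if i < j ∧ σ j < σ i then superSign e (σ i) (σ j) else 1 := by
  rw [permSign, Equiv.Perm.sign_eq_prod_prod_Ioi, ← Finset.prod_mul_distrib]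
  refine Finset.prod_congr rfl fun i _ => ?_
  have : Finset.Ioi i = Finset.univ.filter (fun j => i < j) := by ext; simp
  rw [this, Finset.prod_filter, ← Finset.prod_mul_distrib]
  refine Finset.prod_congr rfl fun j _ => ?_
  by_cases hij : i < j
  · rcases lt_trichotomy (σ i) (σ j) with h | h | h
    · simp [hij, h, h.not_gt]
    · exact absurd (σ.injective h) hij.ne
    · simp [hij, h, h.le, superSign]
  · simp [hij]

theorem permSign_consPerm {n : ℕ} (e : Fin (n + 1) → ZMod 2) (i : Fin (n + 1))
    (τ : Equiv.Perm (Fin n)) :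
    permSign e (consPerm i τ) = moveSign e i * permSign (fun k => e (i.succAbove k)) τ := by
  rw [permSign_eq_prod, permSign_eq_prod, Fin.prod_univ_succ, ← prod_superSign_eq_moveSign]
  congr 1
  · rw [Fin.prod_univ_succ]
    simp only [lt_self_iff_false, false_and, if_false, one_mul, Fin.succ_pos, true_and,
      consPerm_zero, consPerm_succ]
    rw [Equiv.prod_comp τ (fun k => if i.succAbove k < i then superSign e i (i.succAbove k) else 1)]
    have : Finset.Iio i = Finset.univ.filter (fun j => j < i) := by ext; simp
    rw [this, Finset.prod_filter, Fin.prod_univ_succAbove _ i]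
    simp
  · refine Finset.prod_congr rfl fun a _ => ?_
    rw [Fin.prod_univ_succ]
    simp only [Fin.not_lt_zero, false_and, if_false, one_mul, Fin.succ_lt_succ_iff, consPerm_succ,
      Fin.succAbove_lt_succAbove_iff]
    rfl

theorem moveSign_one {n : ℕ} (e : Fin (n + 2) → ZMod 2) : moveSign e 1 = superSign e 1 0 := by
  rw [← Fin.succ_zero_eq_one, moveSign_succ, moveSign_zero, mul_one]

theorem permSign_one {n : ℕ} (e : Fin n → ZMod 2) : permSign e 1 = 1 := by
  rw [permSign_eq_prod]
  refine Finset.prod_eq_one fun i _ => Finset.prod_eq_one fun j _ => if_neg ?_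
  simp only [Equiv.Perm.coe_one, id]
  exact fun h => lt_asymm h.1 h.2

/-! ### Forms on words indexed by `Fin n`, and antisymmetrisation -/

variable {ι F : Type*} [Field F]

/-- The exchange sign `-(-1)^{|x||y|}` as an element of the field. -/
def superFactor (F : Type*) [Field F] (par : ι → ZMod 2) (x y : ι) : F := sgn F (superSign par x y)

theorem superFactor_comm (par : ι → ZMod 2) (x y : ι) :
    superFactor F par x y = superFactor F par y x := by
  rw [superFactor, superSign_comm, superFactor]

theorem superFactor_sq (par : ι → ZMod 2) (x y : ι) :
    superFactor F par x y * superFactor F par x y = 1 := sgn_mul_self F _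

theorem ofFn_comp_consPerm {n : ℕ} (s : Fin (n + 1) → ι) (i : Fin (n + 1))
    (τ : Equiv.Perm (Fin n)) :
    List.ofFn (fun k => s (consPerm i τ k))
      = s i :: List.ofFn (fun k => s (i.succAbove (τ k))) := by
  rw [List.ofFn_succ]; simp

variable {par : ι → ZMod 2}

theorem IsHom.ext_ofFn [CharZero F] {n : ℕ} {α β : List ι → F}
    (hα : IsHom (fun _ => 1) (n : F) α) (hβ : IsHom (fun _ => 1) (n : F) β)
    (h : ∀ s : Fin n → ι, α (List.ofFn s) = β (List.ofFn s)) : α = β := by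
  ext w
  by_cases hw : w.length = n
  · subst hw
    simpa using h w.get
  · have h0 : ∀ γ : List ι → F, IsHom (fun _ => 1) (n : F) γ → γ w = 0 := fun γ hγ => by
      by_contra h
      exact hw (by simpa using hγ w h)
    rw [h0 α hα, h0 β hβ]

theorem IsSuper.apply_move {α : List ι → F} (hα : IsSuper (superFactor F par) α) {n : ℕ}
    (s : Fin (n + 1) → ι) (i : Fin (n + 1)) :
    α (s i :: List.ofFn fun k => s (i.succAbove k))
      = sgn F (moveSign (fun k => par (s k)) i) * α (List.ofFn s) := by
  induction n generalizing α with
  | zero =>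
    obtain rfl : i = 0 := Fin.fin_one_eq_zero i
    simp [moveSign_zero, List.ofFn_succ]
  | succ n ih =>
    refine Fin.cases ?_ (fun j => ?_) i
    · simp [moveSign_zero, List.ofFn_succ]
    · have h := ih (hα.contract (s 0)) (fun k => s k.succ) j
      simp only [contract_apply] at h
      rw [moveSign_succ, map_mul, mul_assoc, List.ofFn_succ (f := s), ← h, List.ofFn_succ]
      simp only [Fin.succ_succAbove_zero, Fin.succ_succAbove_succ]
      rw [superSign_comm]
      exact hα [] _ _ _

theorem IsSuper.apply_perm {α : List ι → F} (hα : IsSuper (superFactor F par) α) {n : ℕ}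
    (s : Fin n → ι) (σ : Equiv.Perm (Fin n)) :
    α (List.ofFn fun k => s (σ k))
      = sgn F (permSign (fun k => par (s k)) σ) * α (List.ofFn s) := by
  induction n generalizing α with
  | zero => simp [permSign_eq_prod]
  | succ n ih =>
    obtain ⟨⟨i, τ⟩, rfl⟩ := (consPerm_bijective n).2 σ
    have h := ih (hα.contract (s i)) (fun k => s (i.succAbove k)) τ
    simp only [contract_apply] at h
    rw [ofFn_comp_consPerm, h, hα.apply_move, permSign_consPerm, map_mul]
    ring

theorem isSuper_of_apply_perm {α : List ι → F}
    (h : ∀ (n : ℕ) (s : Fin n → ι) (σ : Equiv.Perm (Fin n)), α (List.ofFn fun k => s (σ k))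
      = sgn F (permSign (fun k => par (s k)) σ) * α (List.ofFn s)) :
    IsSuper (superFactor F par) α := by
  intro u
  induction u generalizing α with
  | nil =>
    intro x y v
    have h1 := h (v.length + 2) (Fin.cons x (Fin.cons y v.get)) (consPerm 1 1)
    rw [ofFn_comp_consPerm, permSign_consPerm, moveSign_one, permSign_one, mul_one] at h1
    rw [List.ofFn_succ, List.ofFn_succ, List.ofFn_succ] at h1
    simpa [superFactor, superSign, mul_comm] using h1
  | cons a u ih =>
    intro x y v
    refine ih (α := contract a α) (fun n s σ => ?_) x y v
    have h1 := h (n + 1) (Fin.cons a s) (consPerm 0 σ)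
    rw [ofFn_comp_consPerm, permSign_consPerm, moveSign_zero, one_mul, List.ofFn_succ (f := Fin.cons a s)] at h1
    simpa using h1

variable [DecidableEq ι] [Fintype ι]

theorem sum_dual_mul_ofFn (B : ι → List ι → F) {n : ℕ} (s : Fin (n + 1) → ι) :
    (∑ k, mul (superFactor F par) (dual k) (B k)) (List.ofFn s)
      = ∑ i, sgn F (moveSign (fun k => par (s k)) i) *
          B (s i) (List.ofFn fun k => s (i.succAbove k)) := by
  induction n generalizing B with
  | zero =>
    rw [List.ofFn_succ, sum_dual_mul_cons]
    simp [moveSign_zero, dual]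
  | succ n ih =>
    rw [List.ofFn_succ, sum_dual_mul_cons, ih]
    conv_rhs => rw [Fin.sum_univ_succ, moveSign_zero]
    congr 1
    · simp
    · refine Finset.sum_congr rfl fun j _ => ?_
      rw [moveSign_succ, List.ofFn_succ (f := fun k => s (j.succ.succAbove k)), superSign_comm]
      simp only [Fin.succ_succAbove_zero, Fin.succ_succAbove_succ, map_mul]
      simp only [Pi.smul_apply, contract_apply, smul_eq_mul, superFactor, superSign]
      ring

open scoped Nat in
/-- The sum over all permutations in the definition of the cup product is `p! q!` times the shuffle
product. Grouping the permutations by the first letter gives `∑ₖ ξₖ · (ι_k α · β)` in terms of the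
same statement for `ι_k α`, and Euler's identity for `α` concludes. -/
theorem sum_permSign_mul [CharZero F] {α β : List ι → F} {p q n : ℕ} (hn : p + q = n)
    (hα : IsSuper (superFactor F par) α) (hβ : IsSuper (superFactor F par) β)
    (hp : IsHom (fun _ => 1) (p : F) α) (s : Fin n → ι) :
    ∑ σ : Equiv.Perm (Fin n), sgn F (permSign (fun k => par (s k)) σ) *
        (α ((List.ofFn fun k => s (σ k)).take p) * β ((List.ofFn fun k => s (σ k)).drop p))
      = (p ! * q ! : F) * mul (superFactor F par) α β (List.ofFn s) := by
  induction p generalizing α n with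
  | zero =>
    obtain rfl : q = n := by omega
    have h0 : α = α [] • unit := by
      ext w
      rcases w with _ | ⟨x, w⟩
      · simp [unit]
      · have h1 : IsHom (fun _ => ((1 : ℕ) : F)) 0 α := by simpa using hp
        simpa [unit] using congrFun (h1.contract_eq_zero (x := x) one_ne_zero) w
    rw [h0, map_smul, LinearMap.smul_apply, unit_mul]
    simp only [List.take_zero, List.drop_zero, hβ.apply_perm]
    have : ∀ σ : Equiv.Perm (Fin q), sgn F (permSign (fun k => par (s k)) σ) * ((α [] • unit : List ι → F) [] *
        (sgn F (permSign (fun k => par (s k)) σ) * β (List.ofFn s))) = α [] * β (List.ofFn s) := by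
      intro σ
      simp only [unit, Pi.smul_apply, if_true, smul_eq_mul, mul_one]
      linear_combination (α [] * β (List.ofFn s)) * sgn_mul_self F (permSign (fun k => par (s k)) σ)
    simp only [this]
    simp [Fintype.card_perm]
  | succ p ih =>
    obtain ⟨n, rfl⟩ : ∃ m, n = m + 1 := ⟨p + q, by omega⟩
    have hp' : ∀ x, IsHom (fun _ => 1) (p : F) (contract x α) := fun x => by
      simpa using hp.contract x
    have h := hα.euler (superFactor_sq par) hp
    have h2 := congrFun (congrArg (fun ψ => mul (superFactor F par) ψ β) h) (List.ofFn s)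
    simp only [one_smul, map_sum, LinearMap.sum_apply, mul_assoc', map_smul,
      LinearMap.smul_apply] at h2
    rw [sum_dual_mul_ofFn] at h2
    rw [sum_perm_succ, Nat.factorial_succ]
    simp only [ofFn_comp_consPerm, List.take_succ_cons, List.drop_succ_cons, permSign_consPerm,
      map_mul]
    have h3 : ∀ i : Fin (n + 1), _ := fun i =>
      ih (n := n) (by omega) (hα.contract (s i)) (hp' (s i)) (fun k => s (i.succAbove k))
    simp only [contract_apply] at h3
    rw [Pi.smul_apply, smul_eq_mul] at h2
    calc _ = ∑ i, (p ! * q ! : F) * (sgn F (moveSign (fun k => par (s k)) i) *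
          mul (superFactor F par) (contract (s i) α) β
            (List.ofFn fun k => s (i.succAbove k))) := by
          refine Finset.sum_congr rfl fun i _ => ?_
          rw [mul_left_comm, ← h3 i, Finset.mul_sum]
          exact Finset.sum_congr rfl fun τ _ => mul_assoc _ _ _
      _ = _ := by
          rw [← Finset.mul_sum, h2]
          push_cast
          ring

end WordForm

/-! ### The differential of scalar forms -/

namespace WordForm

variable {ι F : Type*} [Field F]
variable {par : ι → ZMod 2} {Ω : ι → ι → F} {star : ι}

/-- The sign of the term of the differential containing the bracket of the `j`-th argument and the
`j.succAbove k`-th argument. -/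
def bracketSign {n : ℕ} (e : Fin (n + 1) → ZMod 2) (j : Fin (n + 1)) (k : Fin n) : ℤˣ :=
  (-1 : ℤˣ) ^ (j : ℕ) * (-1 : ℤˣ) ^ (e j * ∑ l ∈ Finset.Ioo (j.succAbove k) j, e l)

theorem bracketSign_succ_zero {n : ℕ} (e : Fin (n + 2) → ZMod 2) (j : Fin (n + 1)) :
    bracketSign e j.succ 0 = - moveSign (fun k => e k.succ) j := by
  rw [bracketSign, moveSign, Fin.succ_succAbove_zero, sum_Ioo_eq, sum_Iio_eq, Fin.sum_univ_succ]
  simp [pow_succ]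

theorem bracketSign_succ_succ {n : ℕ} (e : Fin (n + 2) → ZMod 2) (j : Fin (n + 1)) (k : Fin n) :
    bracketSign e j.succ k.succ = - bracketSign (fun k => e k.succ) j k := by
  rw [bracketSign, bracketSign, Fin.succ_succAbove_succ, sum_Ioo_eq, sum_Ioo_eq,
    Fin.sum_univ_succ]
  simp [pow_succ]

variable [DecidableEq ι] [Fintype ι]

/-- The differential of a super-alternating scalar form `α` is `-ω · ι_star α`. -/
theorem HeisenbergData.sum_bracketSign (H : HeisenbergData (superFactor F par) star Ω)
    {α : List ι → F} (hα : IsSuper (superFactor F par) α) {n : ℕ} (s : Fin (n + 1) → ι) :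
    ∑ j : Fin (n + 1), ∑ k : Fin n, (if j.succAbove k < j then
        sgn F (bracketSign (fun i => par (s i)) j k) * (Ω (s (j.succAbove k)) (s j) *
          α (List.ofFn (Function.update (fun i => s (j.succAbove i)) k star))) else 0)
      = - mul (superFactor F par) (twoForm Ω) (contract star α) (List.ofFn s) := by
  induction n generalizing α with
  | zero =>
    rw [List.ofFn_succ, mul_cons]
    simp [twoForm]
  | succ n ih =>
    have h1 := ih (hα.contract (s 0)) (fun k => s k.succ)
    simp only [contract_apply] at h1
    have h2 := sum_dual_mul_ofFn (par := par) (fun y => Ω (s 0) y • contract star α)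
      (fun k => s k.succ)
    simp only [map_smul] at h2
    have h3 : mul (superFactor F par) (contract (s 0) (twoForm Ω)) (contract star α)
        = ∑ k, Ω (s 0) k • mul (superFactor F par) (dual k) (contract star α) := by
      rw [contract_twoForm, map_sum, LinearMap.sum_apply]
      simp
    rw [List.ofFn_succ, mul_cons, h3, h2, H.hasFactor (s 0), hα.contract_comm (s 0) star,
      map_smul, map_smul, LinearMap.smul_apply, smul_smul]
    beta_reduce
    rw [mul_neg, H.sq, neg_one_smul, Pi.neg_apply, ← h1, neg_add]
    rw [Fin.sum_univ_succ]
    simp only [Fin.not_lt_zero, if_false, Finset.sum_const_zero, zero_add]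
    rw [← Finset.sum_neg_distrib, ← Finset.sum_neg_distrib, ← Finset.sum_add_distrib]
    refine Finset.sum_congr rfl fun j _ => ?_
    rw [Fin.sum_univ_succ, ← Finset.sum_neg_distrib]
    simp only [Fin.succ_succAbove_zero, Fin.succ_succAbove_succ, Fin.succ_lt_succ_iff,
      Fin.succ_pos, if_true, bracketSign_succ_zero, bracketSign_succ_succ, sgn_neg]
    congr 1
    · rw [List.ofFn_succ]
      simp
    · refine Finset.sum_congr rfl fun k _ => ?_
      split_ifs
      · rw [List.ofFn_succ]
        simp only [neg_mul]
        congr 5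
        refine congrArg _ (funext fun i => ?_)
        by_cases hi : i = k
        · subst hi; simp
        · simp [hi]
      · simp

end WordForm

/-! ### Multilinear maps in a homogeneous basis -/

namespace LieSuperalgebra

open WordForm

variable {F : Type*} {g : Type*} [Field F] [AddCommGroup g] [Module F g]

theorem proj_of_mem (L : LieSuperalgebra F g) {i : ZMod 2} {x : g} (hx : x ∈ L.part i)
    (k : ZMod 2) : L.proj k x = if i = k then x else 0 := by
  let _ := L.isInternal.chooseDecomposition
  have h : L.proj k x = (DirectSum.decompose L.part x k : g) := rfl
  rw [h]
  split_ifs with hk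
  · subst hk; exact DirectSum.decompose_of_mem_same _ hx
  · exact DirectSum.decompose_of_mem_ne _ hx hk

theorem proj_mem (L : LieSuperalgebra F g) (k : ZMod 2) (x : g) : L.proj k x ∈ L.part k := by
  let _ := L.isInternal.chooseDecomposition
  exact (DirectSum.decompose L.part x k).2

theorem sum_proj (L : LieSuperalgebra F g) (x : g) : ∑ k, L.proj k x = x := by
  let _ := L.isInternal.chooseDecomposition
  classical
  conv_rhs => rw [← DirectSum.sum_support_decompose L.part x]
  refine (Finset.sum_subset (Finset.subset_univ _) fun k _ hk => ?_).symm
  have hk' : DirectSum.decompose L.part x k = 0 := by simpa using hk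
  exact congrArg Subtype.val hk'

theorem bracket_proj (L : LieSuperalgebra F g) {i : ZMod 2} {x : g} (hx : x ∈ L.part i)
    (k : ZMod 2) (y : g) : L.bracket x (L.proj k y) = L.proj (i + k) (L.bracket x y) := by
  conv_rhs => rw [← L.sum_proj y, map_sum, map_sum]
  rw [Finset.sum_eq_single k]
  · rw [L.proj_of_mem (L.bracket_mem _ _ x hx _ (L.proj_mem k y)), if_pos rfl]
  · intro l _ hl
    rw [L.proj_of_mem (L.bracket_mem _ _ x hx _ (L.proj_mem l y)), if_neg]
    simpa using hl
  · simp

theorem bracket_proj_eq_zero (L : LieSuperalgebra F g) {y : g}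
    (h : ∀ x, L.bracket x y = 0) (x : g) (k : ZMod 2) : L.bracket x (L.proj k y) = 0 := by
  rw [← L.sum_proj x, map_sum, LinearMap.sum_apply]
  refine Finset.sum_eq_zero fun i _ => ?_
  rw [L.bracket_proj (L.proj_mem i x), h, map_zero]

theorem mem_center_of_bracket_right (L : LieSuperalgebra F g) {y : g}
    (h : ∀ x, L.bracket x y = 0) : y ∈ L.center := by
  rw [center, LinearMap.mem_ker]
  ext x
  rw [← L.sum_proj x, ← L.sum_proj y, map_sum, map_sum]
  simp only [LinearMap.sum_apply, LinearMap.zero_apply]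
  refine Finset.sum_eq_zero fun i _ => Finset.sum_eq_zero fun k _ => ?_
  rw [L.skew _ _ _ (L.proj_mem k y) _ (L.proj_mem i x), L.bracket_proj_eq_zero h]
  simp

/-- A homogeneous basis adapted to a Heisenberg Lie superalgebra. It contains a vector `b star` that
spans the derived algebra, the bracket has the matrix `Ω` with values in `F (b star)`, and
`∑ⱼ N k j • b j`, for `k ≠ star`, is the vector whose bracket with `b x` is `b star` for `x = k` and
zero for `x ≠ k`. -/
structure HeisenbergBasis (L : LieSuperalgebra F g) (ι : Type*) [Fintype ι] [DecidableEq ι] where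
  b : Module.Basis ι F g
  par : ι → ZMod 2
  mem_part : ∀ i, b i ∈ L.part (par i)
  star : ι
  Ω : ι → ι → F
  bracket_eq : ∀ i j, L.bracket (b i) (b j) = Ω i j • b star
  left : ∀ i, Ω star i = 0
  right : ∀ i, Ω i star = 0
  degree : ∀ i j, Ω i j ≠ 0 → par i + par j = par star
  nonzero : ∃ i j, Ω i j ≠ 0
  N : ι → ι → F
  dual_eq : ∀ x k, k ≠ star → ∑ j, Ω x j * N k j = if x = k then 1 else 0

/-- The `i`-th coordinate of a multilinear map in `n` arguments, as a scalar form; it is zero on words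
of length other than `n`. -/
noncomputable def coord {ι : Type*} (b : Module.Basis ι F g) {n : ℕ}
    (f : MultilinearMap F (fun _ : Fin n => g) g) (i : ι) : List ι → F := fun w =>
  if h : w.length = n then b.repr (f fun k => b (w.get (k.cast h.symm))) i else 0

theorem coord_ofFn {ι : Type*} (b : Module.Basis ι F g) {n : ℕ}
    (f : MultilinearMap F (fun _ : Fin n => g) g) (i : ι) (s : Fin n → ι) :
    coord b f i (List.ofFn s) = b.repr (f fun k => b (s k)) i := by
  rw [coord, dif_pos (List.length_ofFn)]
  congr 3
  ext k
  simp

theorem coord_of_length_ne {ι : Type*} (b : Module.Basis ι F g) {n : ℕ}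
    (f : MultilinearMap F (fun _ : Fin n => g) g) (i : ι) {w : List ι} (hw : w.length ≠ n) :
    coord b f i w = 0 := dif_neg hw

theorem isHom_coord {ι : Type*} (b : Module.Basis ι F g) {n : ℕ}
    (f : MultilinearMap F (fun _ : Fin n => g) g) (i : ι) :
    IsHom (fun _ => 1) (n : F) (coord b f i) := by
  intro w hw
  have : w.length = n := by by_contra h; exact hw (coord_of_length_ne b f i h)
  simp [this]

section Coordinates

variable {ι : Type*}

theorem isSuper_coord {L : LieSuperalgebra F g} {b : Module.Basis ι F g} {par : ι → ZMod 2}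
    (hb : ∀ i, b i ∈ L.part (par i)) {n : ℕ} {f : MultilinearMap F (fun _ : Fin n => g) g}
    (hf : f ∈ L.cochains n) (i : ι) : IsSuper (superFactor F par) (coord b f i) := by
  refine isSuper_of_apply_perm fun m s σ => ?_
  by_cases hm : m = n
  · subst hm
    rw [coord_ofFn, coord_ofFn, hf (fun k => par (s k)) (fun k => b (s k)) (fun k => hb _) σ,
      units_smul_eq F]
    simp
  · rw [coord_of_length_ne _ _ _ (by simpa using hm), coord_of_length_ne _ _ _ (by simpa using hm),
      mul_zero]

theorem proj_basis {L : LieSuperalgebra F g} {b : Module.Basis ι F g} {par : ι → ZMod 2}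
    (hb : ∀ i, b i ∈ L.part (par i)) (k : ZMod 2) (i : ι) :
    L.proj k (b i) = if par i = k then b i else 0 := L.proj_of_mem (hb i) k

theorem repr_proj {L : LieSuperalgebra F g} {b : Module.Basis ι F g} {par : ι → ZMod 2}
    (hb : ∀ i, b i ∈ L.part (par i)) (k : ZMod 2) (y : g) (i : ι) :
    b.repr (L.proj k y) i = if par i = k then b.repr y i else 0 := by
  classical
  have h : (b.coord i).comp (L.proj k) = (if par i = k then (1 : F) else 0) • b.coord i := by
    refine b.ext fun j => ?_
    simp only [LinearMap.comp_apply, proj_basis hb, LinearMap.smul_apply, Module.Basis.coord_apply]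
    by_cases hij : j = i
    · subst hij; split_ifs <;> simp
    · split_ifs <;> simp [hij]
  have := LinearMap.congr_fun h y
  rw [LinearMap.smul_apply, smul_eq_mul, ite_mul, one_mul, zero_mul] at this
  exact this

theorem restrict_basis {L : LieSuperalgebra F g} {b : Module.Basis ι F g} {par : ι → ZMod 2}
    (hb : ∀ i, b i ∈ L.part (par i)) {n : ℕ} (e : Fin n → ZMod 2)
    (f : MultilinearMap F (fun _ : Fin n => g) g) (s : Fin n → ι) :
    L.restrict e f (fun k => b (s k))
      = if e = (fun k => par (s k)) then f (fun k => b (s k)) else 0 := by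
  simp only [restrict, MultilinearMap.compLinearMap_apply, proj_basis hb]
  split_ifs with h
  · subst h; simp
  · obtain ⟨k, hk⟩ := Function.ne_iff.1 h
    exact f.map_coord_zero k (if_neg (Ne.symm hk))

theorem parityPart_basis {L : LieSuperalgebra F g} {b : Module.Basis ι F g} {par : ι → ZMod 2}
    (hb : ∀ i, b i ∈ L.part (par i)) {n : ℕ} (δ : ZMod 2)
    (f : MultilinearMap F (fun _ : Fin n => g) g) (s : Fin n → ι) :
    L.parityPart δ f (fun k => b (s k))
      = L.proj (δ + ∑ i, par (s i)) (f fun k => b (s k)) := by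
  rw [parityPart, sum_apply, Finset.sum_eq_single (fun k => par (s k))]
  · rw [LinearMap.compMultilinearMap_apply, restrict_basis hb, if_pos rfl]
  · intro e _ he
    rw [LinearMap.compMultilinearMap_apply, restrict_basis hb, if_neg he, map_zero]
  · simp

theorem mem_cochains_of_isSuper [Finite ι] {L : LieSuperalgebra F g} {b : Module.Basis ι F g}
    {par : ι → ZMod 2}
    (hb : ∀ i, b i ∈ L.part (par i)) {n : ℕ} {f : MultilinearMap F (fun _ : Fin n => g) g}
    (hf : ∀ i, IsSuper (superFactor F par) (coord b f i)) : f ∈ L.cochains n := by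
  intro e x hx σ
  have h : L.restrict e (f.domDomCongr σ) = permSign e σ • L.restrict e f := by
    refine Module.Basis.ext_multilinear (fun _ => b) fun s => ?_
    rw [smul_apply, restrict_basis hb, restrict_basis hb]
    split_ifs with he
    · subst he
      refine b.repr.injective (Finsupp.ext fun i => ?_)
      have h1 := (hf i).apply_perm s σ
      rw [coord_ofFn, coord_ofFn] at h1
      rw [units_smul_eq F]
      simpa using h1
    · simp
  have h1 := congrFun (congrArg DFunLike.coe h) x
  simp only [restrict, MultilinearMap.compLinearMap_apply, smul_apply,
    MultilinearMap.domDomCongr_apply] at h1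
  have h2 : ∀ i, L.proj (e i) (x i) = x i := fun i => by rw [L.proj_of_mem (hx i), if_pos rfl]
  simpa only [h2] using h1

theorem exists_multilinear_of_basis [Fintype ι] (b : Module.Basis ι F g) {n : ℕ}
    (v : (Fin n → ι) → g) : ∃ f : MultilinearMap F (fun _ : Fin n => g) g,
      ∀ s : Fin n → ι, f (fun k => b (s k)) = v s := by
  classical
  refine ⟨∑ t : Fin n → ι, ((MultilinearMap.mkPiAlgebra F (Fin n) F).compLinearMap
    fun k => b.coord (t k)).smulRight (v t), fun s => ?_⟩
  rw [sum_apply, Finset.sum_eq_single s]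
  · simp
  · intro t _ ht
    obtain ⟨k, hk⟩ := Function.ne_iff.1 ht
    have : ∏ k, (b.repr (b (s k))) (t k) = 0 :=
      Finset.prod_eq_zero (Finset.mem_univ k) (by simp [hk.symm])
    simp [-Module.Basis.repr_self, this]
  · simp

end Coordinates

namespace HeisenbergBasis

variable {ι : Type*} [Fintype ι] [DecidableEq ι] {L : LieSuperalgebra F g}
  (B : L.HeisenbergBasis ι)

theorem data : HeisenbergData (superFactor F B.par) B.star B.Ω where
  symm := superFactor_comm _
  sq := superFactor_sq _
  left := B.left
  right := B.right
  nonzero := B.nonzero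
  degree := fun x y h k => by
    rw [superFactor, superFactor, superFactor, ← map_mul, ← sgn_neg, superSign, superSign,
      superSign, ← B.degree x y h, mul_add, uzpow_add]
    simp

theorem bracket_basis (x : ι) (y : g) :
    L.bracket (B.b x) y = (∑ j, B.Ω x j * B.b.repr y j) • B.b B.star := by
  conv_lhs => rw [← B.b.sum_repr y, map_sum]
  rw [Finset.sum_smul]
  refine Finset.sum_congr rfl fun j _ => ?_
  rw [map_smul, B.bracket_eq, smul_smul, mul_comm]

theorem bracket_eq_smul (x y : g) :
    L.bracket x y = (∑ i, ∑ j, B.Ω i j * (B.b.repr x i * B.b.repr y j)) • B.b B.star := by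
  conv_lhs => rw [← B.b.sum_repr x, map_sum]
  rw [LinearMap.sum_apply, Finset.sum_smul]
  refine Finset.sum_congr rfl fun i _ => ?_
  rw [map_smul, LinearMap.smul_apply, B.bracket_basis, smul_smul, Finset.mul_sum]
  congr 1
  exact Finset.sum_congr rfl fun j _ => by ring

/-- Only one parity contributes to a term `[xᵢ, f (…)]` of the differential, because the bracket has
values in `F z`. -/
theorem sum_parity_bracket (x : ι) (m : ZMod 2) (y : g) :
    ∑ δ : ZMod 2, (-1 : ℤˣ) ^ (B.par x * δ) • L.bracket (B.b x) (L.proj (δ + m) y)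
      = (-1 : ℤˣ) ^ (B.par x * (B.par B.star + B.par x + m)) • L.bracket (B.b x) y := by
  have key : ∀ δ, L.bracket (B.b x) (L.proj (δ + m) y)
      = if δ = B.par B.star + B.par x + m then L.bracket (B.b x) y else 0 := by
    intro δ
    rw [L.bracket_proj (B.mem_part x), B.bracket_basis, map_smul, proj_basis B.mem_part]
    have : B.par B.star = B.par x + (δ + m) ↔ δ = B.par B.star + B.par x + m := by
      generalize B.par B.star = a; generalize B.par x = b
      revert a b δ m; decide
    simp only [this]
    split_ifs <;> simp
  simp only [key]
  rw [Finset.sum_eq_single (B.par B.star + B.par x + m)]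
  · simp
  · intro δ _ hδ; simp [hδ]
  · simp

/-- The differential on tuples of basis vectors, with the sum over parities carried out. -/
theorem d_basis {n : ℕ} (f : MultilinearMap F (fun _ : Fin n => g) g) (s : Fin (n + 1) → ι) :
    L.d n f (fun k => B.b (s k))
      = (∑ i, (moveSign (fun k => B.par (s k)) i *
            (-1 : ℤˣ) ^ (B.par (s i) * (B.par B.star + B.par (s i)
              + ∑ k, B.par (s (i.succAbove k))))) •
          L.bracket (B.b (s i)) (f fun k => B.b (s (i.succAbove k))))
        + ∑ j : Fin (n + 1), ∑ k : Fin n, if j.succAbove k < j then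
            bracketSign (fun i => B.par (s i)) j k • B.Ω (s (j.succAbove k)) (s j) •
              f (fun i => B.b (Function.update (fun i => s (j.succAbove i)) k B.star i))
          else 0 := by
  have h0 : L.d n f (fun k => B.b (s k)) = _ := sum_apply _ _ _
  rw [h0, Finset.sum_eq_single (fun k => B.par (s k))]
  rotate_left
  · intro e _ he
    rw [restrict_basis B.mem_part, if_neg he]
  · simp
  rw [restrict_basis B.mem_part, if_pos rfl, add_apply]
  congr 1
  · rw [sum_apply]
    simp only [sum_apply]
    rw [Finset.sum_comm]
    refine Finset.sum_congr rfl fun i _ => ?_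
    rw [mul_smul, ← B.sum_parity_bracket, Finset.smul_sum]
    refine Finset.sum_congr rfl fun δ _ => ?_
    rw [smul_apply, ← mul_smul, ← parityPart_basis B.mem_part]
    congr 1
    rw [moveSign, mul_assoc, ← uzpow_add, ← mul_add, add_comm δ]
  · rw [sum_apply]
    refine Finset.sum_congr rfl fun j _ => ?_
    rw [sum_apply]
    refine Finset.sum_congr rfl fun k _ => ?_
    split_ifs with h
    · rw [smul_apply]
      have h1 : L.bracketTerm j k f (fun k => B.b (s k))
          = f (Function.update (fun i => B.b (s (j.succAbove i))) k
              (L.bracket (B.b (s (j.succAbove k))) (B.b (s j)))) := by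
        rw [bracketTerm, LinearMap.uncurryMid_apply]
        refine congrArg f (funext fun i => ?_)
        by_cases hi : i = k
        · subst hi; simp [Fin.removeNth]
        · simp [hi, Fin.removeNth]
      rw [h1, B.bracket_eq, MultilinearMap.map_update_smul]
      congr 3
      funext i
      by_cases hi : i = k
      · subst hi; simp
      · simp [hi]
    · simp

end HeisenbergBasis

end LieSuperalgebra

/-! ### Cocycles and coboundaries -/

namespace LieSuperalgebra

open WordForm

variable {F : Type*} {g : Type*} [Field F] [AddCommGroup g] [Module F g]

namespace HeisenbergBasis

variable {ι : Type*} [Fintype ι] [DecidableEq ι] {L : LieSuperalgebra F g}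
  (B : L.HeisenbergBasis ι)

theorem repr_bracketTerms {n : ℕ} {f : MultilinearMap F (fun _ : Fin n => g) g}
    (i : ι) (hf : IsSuper (superFactor F B.par) (coord B.b f i)) (s : Fin (n + 1) → ι) :
    B.b.repr (∑ j : Fin (n + 1), ∑ k : Fin n, if j.succAbove k < j then
            bracketSign (fun i => B.par (s i)) j k • B.Ω (s (j.succAbove k)) (s j) •
              f (fun i => B.b (Function.update (fun i => s (j.succAbove i)) k B.star i))
          else 0) i
      = - mul (superFactor F B.par) (twoForm B.Ω) (contract B.star (coord B.b f i))
          (List.ofFn s) := by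
  rw [← B.data.sum_bracketSign hf s, map_sum, Finsupp.finsetSum_apply]
  refine Finset.sum_congr rfl fun j _ => ?_
  rw [map_sum, Finsupp.finsetSum_apply]
  refine Finset.sum_congr rfl fun k _ => ?_
  split_ifs
  · rw [coord_ofFn, units_smul_eq F]
    simp
  · simp

theorem repr_bracket_of_ne (x : ι) (y : g) {i : ι} (hi : i ≠ B.star) :
    B.b.repr (L.bracket (B.b x) y) i = 0 := by
  rw [B.bracket_basis]; simp [hi.symm]

theorem repr_d_of_ne {n : ℕ} {f : MultilinearMap F (fun _ : Fin n => g) g}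
    {i : ι} (hi : i ≠ B.star) (hf : IsSuper (superFactor F B.par) (coord B.b f i))
    (s : Fin (n + 1) → ι) :
    B.b.repr (L.d n f (fun k => B.b (s k))) i
      = - mul (superFactor F B.par) (twoForm B.Ω) (contract B.star (coord B.b f i))
          (List.ofFn s) := by
  rw [B.d_basis, map_add, Finsupp.add_apply, B.repr_bracketTerms i hf, map_sum,
    Finsupp.finsetSum_apply, Finset.sum_eq_zero, zero_add]
  intro k _
  rw [units_smul_eq F, map_smul, Finsupp.smul_apply, B.repr_bracket_of_ne _ _ hi, smul_zero]

/-- The components of a cocycle complementary to the centre are closed scalar forms. -/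
theorem coord_mem_closedForms [CharZero F] {n : ℕ} {f : MultilinearMap F (fun _ : Fin n => g) g}
    (hf : f ∈ L.cocycles n) {i : ι} (hi : i ≠ B.star) :
    coord B.b f i ∈ closedForms (superFactor F B.par) B.star B.Ω n := by
  have hs := isSuper_coord B.mem_part hf.1 i
  refine ⟨hs, isHom_coord _ _ _, ?_⟩
  have h2 : IsHom (fun _ => (1 : F)) 2 (twoForm B.Ω) := isHom_twoForm fun _ _ _ => by norm_num
  have h3 : IsHom (fun _ => (1 : F)) ((n + 1 : ℕ) : F)
      (mul (superFactor F B.par) (twoForm B.Ω) (contract B.star (coord B.b f i))) := by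
    have := h2.mul (c := superFactor F B.par) ((isHom_coord B.b f i).contract_one B.star)
    convert this using 1
    push_cast; ring
  refine h3.ext_ofFn IsHom.zero fun s => ?_
  have h4 := B.repr_d_of_ne hi hs s
  rw [show L.d n f = 0 from hf.2] at h4
  simpa using h4.symm

/-- Forms in the ideal generated by the one-forms, times the central element, are coboundaries. -/
theorem exists_d_eq [CharZero F] {n : ℕ} {γ : ι → List ι → F}
    (hγ : ∀ k, γ k ∈ closedForms (superFactor F B.par) B.star B.Ω (n : F))
    (hstar : γ B.star = 0) : ∃ u ∈ L.cochains n, ∀ s : Fin (n + 1) → ι,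
      L.d n u (fun k => B.b (s k))
        = (∑ k, mul (superFactor F B.par) (dual k) (γ k)) (List.ofFn s) • B.b B.star := by
  -- `G k` is `γ k` up to the sign that cancels the parity sign in the action term of the
  -- differential; it depends on the parities of `k` and of the word.
  set G : ι → List ι → F := fun k => sgn F ((-1) ^ (B.par k * (B.par B.star + B.par k))) •
    twist (fun y => sgn F ((-1) ^ (B.par k * B.par y))) (γ k) with hG
  have hGmem : ∀ k, G k ∈ closedForms (superFactor F B.par) B.star B.Ω (n : F) := by
    intro k
    refine Submodule.smul_mem _ _ (twist_mem_closedForms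
      (μ := sgn F ((-1) ^ (B.par k * B.par B.star))) ?_ ?_ (hγ k))
    · intro h0
      simpa [h0] using sgn_mul_self F ((-1) ^ (B.par k * B.par B.star))
    · intro x y hxy
      rw [← map_mul, ← uzpow_add, ← mul_add, B.degree x y hxy]
  have hGval : ∀ k (s : Fin n → ι), G k (List.ofFn s)
      = sgn F ((-1) ^ (B.par k * (B.par B.star + B.par k + ∑ i, B.par (s i))))
        * γ k (List.ofFn s) := by
    intro k s
    have h1 : ((List.ofFn s).map fun y => sgn F ((-1) ^ (B.par k * B.par y))).prod
        = sgn F ((-1) ^ (B.par k * ∑ i, B.par (s i))) := by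
      rw [List.map_ofFn, List.prod_ofFn]
      simp only [Function.comp]
      rw [← map_prod]
      congr 1
      exact prod_uzpow_mul _ _ _
    simp only [hG, Pi.smul_apply, twist_apply, smul_eq_mul, h1]
    rw [mul_add _ (_ + _), uzpow_add, map_mul]
    ring
  -- The primitive is `∑ₖ G k ⊗ v'ₖ`, where `v'ₖ = ∑ⱼ N k j • b j`.
  obtain ⟨u, hu⟩ := exists_multilinear_of_basis B.b
    (fun s : Fin n → ι => ∑ j, (∑ k, B.N k j * G k (List.ofFn s)) • B.b j)
  have hcoord : ∀ j, coord B.b u j = ∑ k, B.N k j • G k := by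
    intro j
    refine (isHom_coord _ _ _).ext_ofFn
      (IsHom.sum _ fun k _ => (hGmem k).2.1.smul _) fun s => ?_
    rw [coord_ofFn, hu, B.b.repr_sum_self, Finset.sum_apply]
    rfl
  have hsup : ∀ j, IsSuper (superFactor F B.par) (coord B.b u j) := fun j => by
    rw [hcoord]; exact IsSuper.sum _ fun k _ => (hGmem k).1.smul _
  refine ⟨u, mem_cochains_of_isSuper B.mem_part hsup, fun s => ?_⟩
  have hzero : ∀ j, mul (superFactor F B.par) (twoForm B.Ω)
      (contract B.star (coord B.b u j)) = 0 := by
    intro j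
    rw [hcoord, map_sum, map_sum]
    refine Finset.sum_eq_zero fun k _ => ?_
    rw [map_smul, map_smul, (hGmem k).2.2, smul_zero]
  rw [B.d_basis]
  have h5 : ∀ v : g, (∀ i, B.b.repr v i = 0) → v = 0 := fun v hv =>
    B.b.repr.injective (by ext i; simp [hv i])
  rw [h5 _ fun i => (B.repr_bracketTerms i (hsup i) s).trans (by rw [hzero]; simp), add_zero,
    sum_dual_mul_ofFn, Finset.sum_smul]
  refine Finset.sum_congr rfl fun i _ => ?_
  rw [units_smul_eq F, B.bracket_basis, smul_smul]
  congr 1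
  rw [map_mul, mul_assoc]
  congr 1
  have h6 : ∀ j, B.b.repr (u fun k => B.b (s (i.succAbove k))) j
      = ∑ k, B.N k j * G k (List.ofFn fun k => s (i.succAbove k)) := fun j => by
    rw [hu (fun k => s (i.succAbove k)), B.b.repr_sum_self]
  simp only [h6, Finset.mul_sum]
  rw [Finset.sum_comm]
  rw [Finset.sum_eq_single (s i)]
  · by_cases hs : s i = B.star
    · rw [hs, hstar]
      simp [B.left]
    · rw [← Finset.mul_sum]
      simp only [← mul_assoc (B.Ω _ _)]
      rw [← Finset.sum_mul, B.dual_eq _ _ hs, if_pos rfl, one_mul, hGval, ← mul_assoc,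
        sgn_mul_self, one_mul]
  · intro k _ hk
    rw [← Finset.mul_sum]
    simp only [← mul_assoc (B.Ω _ _)]
    rw [← Finset.sum_mul]
    by_cases hs : k = B.star
    · rw [hs, hGval, hstar]
      simp
    · rw [B.dual_eq _ _ hs, if_neg hk.symm]; simp
  · simp

end HeisenbergBasis

end LieSuperalgebra

/-! ### The cup product -/

namespace LieSuperalgebra

open WordForm

variable {F : Type*} {g : Type*} [Field F] [AddCommGroup g] [Module F g]

theorem cup_eq_zero_of_bracket (L : LieSuperalgebra F g) {p q : ℕ}
    (f : MultilinearMap F (fun _ : Fin p => g) g) (h : MultilinearMap F (fun _ : Fin q => g) g)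
    (H : ∀ x y δ, L.bracket (f x) (L.parityPart δ h y) = 0) : L.cup f h = 0 := by
  rw [cup]
  refine smul_eq_zero_of_right _ (Finset.sum_eq_zero fun σ _ => Finset.sum_eq_zero fun e _ =>
    Finset.sum_eq_zero fun δ _ => ?_)
  have : L.shuffleTerm σ f (L.parityPart δ h) = 0 := by
    ext x
    rw [shuffleTerm_apply, H]; rfl
  rw [this]
  ext x
  simp [restrict]

theorem cup_trivial_of_eq_zero (L : LieSuperalgebra F g) {p q : ℕ} (f : L.cocycles p)
    (h : L.cocycles q) (H : L.cup f.1 h.1 = 0) :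
    ∃ hc : L.cup f.1 h.1 ∈ L.cocycles (p + q), L.cohomologyClass ⟨L.cup f.1 h.1, hc⟩ = 0 := by
  refine ⟨H ▸ zero_mem _, (Submodule.Quotient.mk_eq_zero _).2 ?_⟩
  rw [Submodule.submoduleOf, Submodule.mem_comap]
  simp [H]

namespace HeisenbergBasis

variable {ι : Type*} [Fintype ι] [DecidableEq ι] {L : LieSuperalgebra F g}
  (B : L.HeisenbergBasis ι)

/-- The `i`-th coordinate of `f` with the sign `(-1)^{|x'| δ}` of the cup product with a cochain of
parity `δ`. -/
noncomputable def leftFactor {p : ℕ} (f : MultilinearMap F (fun _ : Fin p => g) g) (δ : ZMod 2)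
    (i : ι) : List ι → F :=
  twist (fun y => sgn F ((-1) ^ (δ * B.par y))) (coord B.b f i)

/-- The `j`-th coordinate of the component of parity `δ` of `h`. The projection to words of a given
parity is written as half the sum of the identity and a twist, which makes it visible that closed
forms are preserved. -/
noncomputable def rightFactor {q : ℕ} (h : MultilinearMap F (fun _ : Fin q => g) g) (δ : ZMod 2)
    (j : ι) : List ι → F :=
  (1 / 2 : F) • (coord B.b h j + sgn F ((-1) ^ (B.par j + δ)) •
    twist (fun y => sgn F ((-1) ^ (1 * B.par y))) (coord B.b h j))

theorem twist_ofFn (δ : ZMod 2) (α : List ι → F) {n : ℕ} (s : Fin n → ι) :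
    twist (fun y => sgn F ((-1) ^ (δ * B.par y))) α (List.ofFn s)
      = sgn F ((-1) ^ (δ * ∑ i, B.par (s i))) * α (List.ofFn s) := by
  rw [twist_apply, List.map_ofFn, List.prod_ofFn]
  simp only [Function.comp]
  rw [← map_prod, prod_uzpow_mul]

theorem leftFactor_ofFn {p : ℕ} (f : MultilinearMap F (fun _ : Fin p => g) g) (δ : ZMod 2) (i : ι)
    (s : Fin p → ι) : B.leftFactor f δ i (List.ofFn s)
      = sgn F ((-1) ^ ((∑ i, B.par (s i)) * δ)) * B.b.repr (f fun k => B.b (s k)) i := by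
  rw [leftFactor, twist_ofFn, coord_ofFn, mul_comm δ]

theorem rightFactor_ofFn [CharZero F] {q : ℕ} (h : MultilinearMap F (fun _ : Fin q => g) g)
    (δ : ZMod 2) (j : ι) (s : Fin q → ι) : B.rightFactor h δ j (List.ofFn s)
      = B.b.repr (L.proj (δ + ∑ i, B.par (s i)) (h fun k => B.b (s k))) j := by
  rw [repr_proj B.mem_part, rightFactor, Pi.smul_apply, Pi.add_apply, Pi.smul_apply, twist_ofFn,
    coord_ofFn, one_mul, smul_eq_mul, smul_eq_mul, ← mul_assoc (sgn F _), ← map_mul, ← uzpow_add]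
  have h2 : ∀ a b c : ZMod 2,
      (a = b + c ∧ a + b + c = 0) ∨ (a ≠ b + c ∧ a + b + c = 1) := by decide
  rcases h2 (B.par j) δ (∑ i, B.par (s i)) with ⟨h3, h4⟩ | ⟨h3, h4⟩
  · rw [if_pos h3, h4, uzpow_zero, map_one]; ring
  · rw [if_neg h3, h4, uzpow_one, sgn_neg, map_one]; ring

theorem leftFactor_isSuper {p : ℕ} {f : MultilinearMap F (fun _ : Fin p => g) g}
    (hf : f ∈ L.cochains p) (δ : ZMod 2) (i : ι) :
    IsSuper (superFactor F B.par) (B.leftFactor f δ i) :=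
  (isSuper_coord B.mem_part hf i).twist _

theorem rightFactor_isSuper {q : ℕ} {h : MultilinearMap F (fun _ : Fin q => g) g}
    (hh : h ∈ L.cochains q) (δ : ZMod 2) (j : ι) :
    IsSuper (superFactor F B.par) (B.rightFactor h δ j) :=
  ((isSuper_coord B.mem_part hh j).add (((isSuper_coord B.mem_part hh j).twist _).smul _)).smul _

theorem twist_mem (δ : ZMod 2) {a : F} {α : List ι → F}
    (hα : α ∈ closedForms (superFactor F B.par) B.star B.Ω a) :
    twist (fun y => sgn F ((-1) ^ (δ * B.par y))) α
      ∈ closedForms (superFactor F B.par) B.star B.Ω a := by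
  refine twist_mem_closedForms (μ := sgn F ((-1) ^ (δ * B.par B.star))) ?_ ?_ hα
  · intro h0
    simpa [h0] using sgn_mul_self F ((-1) ^ (δ * B.par B.star))
  · intro x y hxy
    rw [← map_mul, ← uzpow_add, ← mul_add, B.degree x y hxy]

theorem leftFactor_mem [CharZero F] {p : ℕ} {f : MultilinearMap F (fun _ : Fin p => g) g}
    (hf : f ∈ L.cocycles p) (δ : ZMod 2) {i : ι} (hi : i ≠ B.star) :
    B.leftFactor f δ i ∈ closedForms (superFactor F B.par) B.star B.Ω p :=
  B.twist_mem δ (B.coord_mem_closedForms hf hi)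

theorem rightFactor_mem [CharZero F] {q : ℕ} {h : MultilinearMap F (fun _ : Fin q => g) g}
    (hh : h ∈ L.cocycles q) (δ : ZMod 2) {j : ι} (hj : j ≠ B.star) :
    B.rightFactor h δ j ∈ closedForms (superFactor F B.par) B.star B.Ω q :=
  Submodule.smul_mem _ _ (add_mem (B.coord_mem_closedForms hh hj)
    (Submodule.smul_mem _ _ (B.twist_mem 1 (B.coord_mem_closedForms hh hj))))

/-- The coefficient of the central element in the cup product. -/
noncomputable def cupForm {p q : ℕ} (f : MultilinearMap F (fun _ : Fin p => g) g)
    (h : MultilinearMap F (fun _ : Fin q => g) g) : List ι → F :=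
  ∑ δ : ZMod 2, ∑ i, ∑ j, B.Ω i j •
    mul (superFactor F B.par) (B.leftFactor f δ i) (B.rightFactor h δ j)

theorem isHom_leftFactor {p : ℕ} (f : MultilinearMap F (fun _ : Fin p => g) g) (δ : ZMod 2)
    (i : ι) : IsHom (fun _ => 1) (p : F) (B.leftFactor f δ i) := (isHom_coord B.b f i).twist _

theorem isHom_rightFactor {q : ℕ} (h : MultilinearMap F (fun _ : Fin q => g) g) (δ : ZMod 2)
    (j : ι) : IsHom (fun _ => 1) (q : F) (B.rightFactor h δ j) :=
  ((isHom_coord B.b h j).add (((isHom_coord B.b h j).twist _).smul _)).smul _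

theorem cup_basis [CharZero F] {p q : ℕ} {f : MultilinearMap F (fun _ : Fin p => g) g}
    {h : MultilinearMap F (fun _ : Fin q => g) g} (hf : f ∈ L.cochains p) (hh : h ∈ L.cochains q)
    (s : Fin (p + q) → ι) :
    L.cup f h (fun k => B.b (s k)) = B.cupForm f h (List.ofFn s) • B.b B.star := by
  have h1 : ∀ (δ : ZMod 2) (i j : ι), mul (superFactor F B.par) (B.leftFactor f δ i)
      (B.rightFactor h δ j) (List.ofFn s)
      = (1 / ((p.factorial : F) * (q.factorial : F))) * ∑ σ : Equiv.Perm (Fin (p + q)),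
        sgn F (permSign (fun k => B.par (s k)) σ) *
        (B.leftFactor f δ i (List.ofFn fun k => s (σ (Fin.castAdd q k))) *
          B.rightFactor h δ j (List.ofFn fun k => s (σ (Fin.natAdd p k)))) := by
    intro δ i j
    have h2 := sum_permSign_mul rfl (B.leftFactor_isSuper hf δ i) (B.rightFactor_isSuper hh δ j)
      (B.isHom_leftFactor f δ i) s
    simp only [List.ofFn_add, List.take_left' List.length_ofFn,
      List.drop_left' List.length_ofFn] at h2
    rw [← List.ofFn_add] at h2
    have hp : (p.factorial : F) ≠ 0 := Nat.cast_ne_zero.2 p.factorial_ne_zero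
    have hq : (q.factorial : F) ≠ 0 := Nat.cast_ne_zero.2 q.factorial_ne_zero
    rw [eq_comm, one_div, inv_mul_eq_iff_eq_mul₀ (mul_ne_zero hp hq)]
    exact h2
  rw [cup, smul_apply, sum_apply]
  simp only [cupForm, Finset.sum_apply, Pi.smul_apply, h1, smul_eq_mul]
  have h3 : ∀ σ : Equiv.Perm (Fin (p + q)),
      (∑ e : Fin (p + q) → ZMod 2, ∑ δ : ZMod 2,
        ((-1 : ℤˣ) ^ ((∑ i : Fin p, e (σ (Fin.castAdd q i))) * δ) * permSign e σ) •
        L.restrict e (L.shuffleTerm σ f (L.parityPart δ h))) (fun k => B.b (s k))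
      = (∑ δ : ZMod 2, ∑ i, ∑ j, B.Ω i j * (sgn F (permSign (fun k => B.par (s k)) σ) *
        (B.leftFactor f δ i (List.ofFn fun k => s (σ (Fin.castAdd q k))) *
          B.rightFactor h δ j (List.ofFn fun k => s (σ (Fin.natAdd p k)))))) • B.b B.star := by
    intro σ
    rw [sum_apply, Finset.sum_eq_single (fun k => B.par (s k))]
    · rw [sum_apply, Finset.sum_smul]
      refine Finset.sum_congr rfl fun δ _ => ?_
      rw [smul_apply, restrict_basis B.mem_part, if_pos rfl, shuffleTerm_apply,
        parityPart_basis B.mem_part δ h (fun k => s (σ (Fin.natAdd p k))), B.bracket_eq_smul,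
        units_smul_eq F, smul_smul, map_mul, Finset.mul_sum]
      congr 1
      refine Finset.sum_congr rfl fun i _ => ?_
      rw [Finset.mul_sum]
      refine Finset.sum_congr rfl fun j _ => ?_
      rw [leftFactor_ofFn, rightFactor_ofFn]
      ring
    · intro e _ he
      rw [sum_apply]
      refine Finset.sum_eq_zero fun δ _ => ?_
      rw [smul_apply, restrict_basis B.mem_part, if_neg he, smul_zero]
    · simp
  simp only [h3]
  rw [← Finset.sum_smul, smul_smul]
  congr 1
  rw [Finset.sum_comm, Finset.mul_sum]
  refine Finset.sum_congr rfl fun δ _ => ?_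
  rw [Finset.sum_comm, Finset.mul_sum]
  refine Finset.sum_congr rfl fun i _ => ?_
  rw [Finset.sum_comm, Finset.mul_sum]
  refine Finset.sum_congr rfl fun j _ => ?_
  rw [← Finset.mul_sum]
  ring

theorem cupForm_mem [CharZero F] {p q : ℕ} (hp : p ≠ 0) (hq : q ≠ 0)
    {f : MultilinearMap F (fun _ : Fin p => g) g}
    {h : MultilinearMap F (fun _ : Fin q => g) g} (hf : f ∈ L.cocycles p) (hh : h ∈ L.cocycles q) :
    B.cupForm f h ∈ exactForms (superFactor F B.par) B.star B.Ω (p + q - 1) := by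
  refine sum_mem fun δ _ => sum_mem fun i _ => sum_mem fun j _ => ?_
  by_cases hij : B.Ω i j = 0
  · rw [hij, zero_smul]; exact zero_mem _
  · have hi : i ≠ B.star := by rintro rfl; exact hij (B.left j)
    have hj : j ≠ B.star := by rintro rfl; exact hij (B.right i)
    exact Submodule.smul_mem _ _
      (B.data.mul_mem_exactForms hp hq (B.leftFactor_mem hf δ hi) (B.rightFactor_mem hh δ hj))

theorem cupForm_isSuper {p q : ℕ}
    {f : MultilinearMap F (fun _ : Fin p => g) g}
    {h : MultilinearMap F (fun _ : Fin q => g) g} (hf : f ∈ L.cochains p) (hh : h ∈ L.cochains q) :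
    IsSuper (superFactor F B.par) (B.cupForm f h) :=
  IsSuper.sum _ fun δ _ => IsSuper.sum _ fun i _ => IsSuper.sum _ fun j _ =>
    ((B.leftFactor_isSuper hf δ i).mul B.data.symm B.data.sq (B.rightFactor_isSuper hh δ j)).smul _

theorem isHom_cupForm {p q : ℕ} (f : MultilinearMap F (fun _ : Fin p => g) g)
    (h : MultilinearMap F (fun _ : Fin q => g) g) :
    IsHom (fun _ => 1) ((p + q : ℕ) : F) (B.cupForm f h) := by
  rw [Nat.cast_add]
  exact IsHom.sum _ fun δ _ => IsHom.sum _ fun i _ => IsHom.sum _ fun j _ =>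
    ((B.isHom_leftFactor f δ i).mul (B.isHom_rightFactor h δ j)).smul _

theorem coord_cup [CharZero F] {p q : ℕ} {f : MultilinearMap F (fun _ : Fin p => g) g}
    {h : MultilinearMap F (fun _ : Fin q => g) g} (hf : f ∈ L.cochains p) (hh : h ∈ L.cochains q)
    (i : ι) : coord B.b (L.cup f h) i = if i = B.star then B.cupForm f h else 0 := by
  refine (isHom_coord _ _ _).ext_ofFn ?_ fun s => ?_
  · split_ifs
    · exact B.isHom_cupForm f h
    · exact IsHom.zero
  · rw [coord_ofFn, B.cup_basis hf hh]
    split_ifs with hi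
    · simp [hi]
    · simp [Ne.symm hi]

/-- A cocycle of degree zero is central. -/
theorem bracket_eq_zero_of_cocycle (B : L.HeisenbergBasis ι) (f : L.cocycles 0) (x : g) (v : Fin 0 → g) :
    L.bracket x (f.1 v) = 0 := by
  have h1 : ∀ i, L.bracket (B.b i) (f.1 v) = 0 := by
    intro i
    have h2 := B.d_basis f.1 (fun _ => i)
    rw [show L.d 0 f.1 = 0 from f.2.2] at h2
    simp only [Finset.univ_eq_empty, Finset.sum_empty, Finset.sum_const_zero, add_zero,
      Fin.sum_univ_succ, zero_apply] at h2
    have h3 := (smul_eq_zero_iff_eq _).1 h2.symm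
    rwa [Subsingleton.elim v (fun k => B.b i)]
  have h4 : L.bracket.flip (f.1 v) = 0 := B.b.ext fun i => h1 i
  exact LinearMap.congr_fun h4 x

theorem cupProductTrivial [CharZero F] (B : L.HeisenbergBasis ι) : L.CupProductTrivial := by
  intro p q f h
  rcases q with _ | q
  · refine L.cup_trivial_of_eq_zero f h (L.cup_eq_zero_of_bracket _ _ fun x y δ => ?_)
    rw [Subsingleton.elim y fun k => B.b (k.elim0), parityPart_basis B.mem_part]
    exact L.bracket_proj_eq_zero (fun z => B.bracket_eq_zero_of_cocycle h z _) _ _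
  rcases Nat.eq_zero_or_pos p with rfl | hp
  · refine L.cup_trivial_of_eq_zero f h (L.cup_eq_zero_of_bracket _ _ fun x y δ => ?_)
    have h0 := L.mem_center_of_bracket_right fun z => B.bracket_eq_zero_of_cocycle f z x
    rw [center, LinearMap.mem_ker] at h0
    rw [h0, LinearMap.zero_apply]
  obtain ⟨γ, h1, h2, h3⟩ := B.cupForm_mem hp.ne' q.succ_ne_zero f.2 h.2
  have h4 : ((p : F) + (q + 1 : ℕ) - 1) = ((p + q : ℕ) : F) := by push_cast; ring
  rw [h4] at h1
  obtain ⟨u, hu, hdu⟩ := B.exists_d_eq h1 h2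
  have hd : L.d (p + q) u = L.cup f.1 h.1 := by
    refine Module.Basis.ext_multilinear (fun _ => B.b) fun s => ?_
    rw [hdu s, ← h3]
    exact (B.cup_basis f.2.1 h.2.1 s).symm
  have hc := B.coord_cup f.2.1 h.2.1
  have hs : ∀ i, IsSuper (superFactor F B.par) (coord B.b (L.cup f.1 h.1) i) := fun i => by
    rw [hc]
    split_ifs
    · exact B.cupForm_isSuper f.2.1 h.2.1
    · exact IsSuper.zero
  refine ⟨⟨mem_cochains_of_isSuper B.mem_part hs, ?_⟩,
    (Submodule.Quotient.mk_eq_zero _).2 ⟨u, hu, hd⟩⟩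
  rw [SetLike.mem_coe, LinearMap.mem_ker]
  refine Module.Basis.ext_multilinear (fun _ => B.b) fun s => ?_
  refine B.b.repr.injective (Finsupp.ext fun i => ?_)
  rw [B.d_basis, map_add, Finsupp.add_apply, B.repr_bracketTerms i (hs i), Finset.sum_eq_zero]
  · rw [hc]
    split_ifs
    · rw [B.data.exact_closed (B.cupForm_mem hp.ne' q.succ_ne_zero f.2 h.2)]; simp
    · simp
  · intro k _
    rw [B.cup_basis f.2.1 h.2.1 (fun l => s (k.succAbove l)), map_smul, B.bracket_eq, B.right]
    simp

end HeisenbergBasis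

end LieSuperalgebra

/-! ### Homogeneous bases of Heisenberg Lie superalgebras -/

namespace LieSuperalgebra

open WordForm

universe v

variable {F : Type*} {g : Type*} [Field F] [AddCommGroup g] [Module F g]

theorem cupProductTrivial_of_bracket_eq_zero (L : LieSuperalgebra F g) (h0 : L.bracket = 0) :
    L.CupProductTrivial := fun p q f h =>
  L.cup_trivial_of_eq_zero f h (L.cup_eq_zero_of_bracket _ _ fun x y δ => by rw [h0]; rfl)

theorem exists_homogeneous_bracket_ne_zero (L : LieSuperalgebra F g) (h : L.lowerCentral 1 ≠ ⊥) :
    ∃ i j, ∃ x ∈ L.part i, ∃ y ∈ L.part j, L.bracket x y ≠ 0 := by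
  by_contra! H
  refine h (Submodule.span_eq_bot.2 ?_)
  rintro w ⟨x, y, -, rfl⟩
  rw [← L.sum_proj x, ← L.sum_proj y, map_sum, map_sum]
  simp only [LinearMap.sum_apply]
  exact Finset.sum_eq_zero fun i _ => Finset.sum_eq_zero fun k _ =>
    H _ _ _ (L.proj_mem _ _) _ (L.proj_mem _ _)

theorem bracket_mem_center (L : LieSuperalgebra F g) (h : L.lowerCentral 2 = ⊥) (x y : g) :
    L.bracket x y ∈ L.center := by
  refine L.mem_center_of_bracket_right fun w => ?_
  have h1 : L.bracket x y ∈ L.lowerCentral 1 := Submodule.subset_span ⟨x, y, trivial, rfl⟩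
  have h2 : L.bracket w (L.bracket x y) ∈ L.lowerCentral 2 :=
    Submodule.subset_span ⟨w, _, h1, rfl⟩
  rwa [h, Submodule.mem_bot] at h2

/-- Every homogeneous element is part of a homogeneous basis. -/
theorem exists_homogeneous_basis {g : Type v} [AddCommGroup g] [Module F g]
    (L : LieSuperalgebra F g) {i₀ : ZMod 2} {z : g}
    (hz : z ∈ L.part i₀) (hz0 : z ≠ 0) :
    ∃ (ι : Type v) (b : Module.Basis ι F g) (par : ι → ZMod 2) (star : ι),
      (∀ i, b i ∈ L.part (par i)) ∧ b star = z ∧ par star = i₀ := by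
  have hli : ∀ i, LinearIndepOn F id {x : L.part i | (x : g) = z} := by
    intro i
    have hsub : {x : L.part i | (x : g) = z}.Subsingleton := fun x hx y hy =>
      Subtype.ext (hx.trans hy.symm)
    rcases hsub.eq_empty_or_singleton with h | ⟨x, h⟩
    · rw [h]; exact linearIndepOn_empty _ _
    · rw [h]
      have hx : (x : g) = z := by
        have : x ∈ {x : L.part i | (x : g) = z} := h ▸ rfl
        exact this
      exact LinearIndepOn.singleton (by rintro h0; exact hz0 (by rw [← hx]; simpa using h0))
  refine ⟨_, L.isInternal.collectedBasis fun i => Module.Basis.extend (hli i), fun a => a.1,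
    ⟨i₀, ⟨⟨z, hz⟩, (hli i₀).subset_extend _ rfl⟩⟩, fun a => ?_, ?_, rfl⟩
  · exact DirectSum.IsInternal.collectedBasis_mem _ _ _
  · rw [DirectSum.IsInternal.collectedBasis_coe]
    simp

theorem IsHeisenberg.exists_heisenbergBasis {g : Type v} [AddCommGroup g] [Module F g]
    [FiniteDimensional F g] {L : LieSuperalgebra F g}
    (hL : L.IsHeisenberg) : ∃ (ι : Type v) (_ : Fintype ι) (_ : DecidableEq ι),
      Nonempty (L.HeisenbergBasis ι) := by
  classical
  obtain ⟨⟨h1, h2⟩, h3⟩ := hL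
  obtain ⟨i, j, x, hx, y, hy, hxy⟩ := L.exists_homogeneous_bracket_ne_zero h1
  obtain ⟨ι, b, par, star, hb, hstar, hpar⟩ :=
    L.exists_homogeneous_basis (L.bracket_mem _ _ _ hx _ hy) hxy
  have : Finite ι := Module.Finite.finite_basis b
  have : Fintype ι := Fintype.ofFinite ι
  have hz : b star ∈ L.center := hstar ▸ L.bracket_mem_center h2 x y
  have hcenter : ∀ w ∈ L.center, ∃ c : F, w = c • b star := by
    intro w hw
    obtain ⟨c, hc⟩ := exists_smul_eq_of_finrank_eq_one h3 (x := ⟨b star, hz⟩)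
      (fun h => b.ne_zero star (congrArg Subtype.val h)) ⟨w, hw⟩
    exact ⟨c, (congrArg Subtype.val hc).symm⟩
  have hbr : ∀ u v, L.bracket u v = b.repr (L.bracket u v) star • b star := by
    intro u v
    obtain ⟨c, hc⟩ := hcenter _ (L.bracket_mem_center h2 u v)
    rw [hc]; simp
  set Ω : ι → ι → F := fun k l => b.repr (L.bracket (b k) (b l)) star with hΩ
  have hleft : ∀ k, Ω star k = 0 := fun k => by
    have : L.bracket (b star) = 0 := hz
    simp [hΩ, this]
  have hright : ∀ k, Ω k star = 0 := fun k => by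
    have h : L.bracket (b star) = 0 := hz
    simp only [hΩ]
    rw [L.skew _ _ _ (hb k) _ (hb star), h]
    simp
  have hdeg : ∀ k l, Ω k l ≠ 0 → par k + par l = par star := by
    intro k l hkl
    by_contra hne
    have h4 := L.bracket_mem _ _ _ (hb k) _ (hb l)
    rw [hbr] at h4
    have h5 := L.proj_of_mem h4 (par star)
    rw [if_neg hne, map_smul, L.proj_of_mem (hb star), if_pos rfl, smul_eq_zero] at h5
    exact h5.elim hkl (b.ne_zero star)
  have hne : ∃ k l, Ω k l ≠ 0 := by
    by_contra! H
    have h0 : L.bracket = 0 := b.ext fun k => b.ext fun l => by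
      rw [hbr]
      change Ω k l • _ = _
      rw [H, zero_smul]; rfl
    exact hxy (by rw [h0]; rfl)
  have hsum : ∀ k v, L.bracket (b k) v = (∑ l, Ω k l * b.repr v l) • b star := by
    intro k v
    conv_lhs => rw [← b.sum_repr v, map_sum]
    rw [Finset.sum_smul]
    refine Finset.sum_congr rfl fun l _ => ?_
    rw [map_smul, hbr, smul_smul, mul_comm]
  -- The matrix of the bracket, made invertible by a one at the place of the central element.
  set M : Matrix ι ι F := Matrix.of fun k l => Ω k l + if k = star ∧ l = star then 1 else 0 with hM
  have hMv : ∀ (v : ι → F) k, M.mulVec v k = ∑ l, Ω k l * v l + if k = star then v star else 0 := by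
    intro v k
    simp only [Matrix.mulVec, dotProduct, hM, Matrix.of_apply, add_mul, Finset.sum_add_distrib]
    congr 1
    by_cases hk : k = star <;> simp [hk]
  have hinj : Function.Injective M.mulVec := by
    refine (injective_iff_map_eq_zero M.mulVecLin).2 fun v hv => ?_
    have hv' : ∀ k, ∑ l, Ω k l * v l + (if k = star then v star else 0) = 0 := fun k => by
      rw [← hMv]; exact congrFun hv k
    have hvs : v star = 0 := by simpa [hleft] using hv' star
    have hcen : (∑ l, v l • b l) ∈ L.center := by
      refine L.mem_center_of_bracket_right fun w => ?_
      have : L.bracket.flip (∑ l, v l • b l) = 0 := b.ext fun k => by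
        rw [LinearMap.flip_apply, hsum]
        have := hv' k
        rw [hvs, ite_self, add_zero] at this
        simp only [b.repr_sum_self, this, zero_smul, LinearMap.zero_apply]
      exact LinearMap.congr_fun this w
    obtain ⟨c, hc⟩ := hcenter _ hcen
    ext k
    have h6 := congrArg (fun w => b.repr w k) hc
    simp only [b.repr_sum_self] at h6
    by_cases hk : k = star
    · subst hk; exact hvs
    · simpa [Ne.symm hk] using h6
  have hunit : M * M⁻¹ = 1 :=
    Matrix.mul_nonsing_inv _
      ((Matrix.isUnit_iff_isUnit_det _).1 (Matrix.mulVec_injective_iff_isUnit.1 hinj))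
  have hentry : ∀ k l, ∑ t, Ω k t * M⁻¹ t l + (if k = star then M⁻¹ star l else 0)
      = if k = l then 1 else 0 := by
    intro k l
    rw [← hMv (fun t => M⁻¹ t l), ← Matrix.one_apply, ← hunit]
    rfl
  refine ⟨ι, inferInstance, inferInstance, ⟨{
    b := b
    par := par
    mem_part := hb
    star := star
    Ω := Ω
    bracket_eq := fun k l => hbr _ _
    left := hleft
    right := hright
    degree := hdeg
    nonzero := hne
    N := fun k l => M⁻¹ l k
    dual_eq := fun k l hl => ?_ }⟩⟩
  have h7 := hentry star l
  rw [if_pos rfl, if_neg (Ne.symm hl)] at h7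
  simp only [hleft, zero_mul, Finset.sum_const_zero, zero_add] at h7
  have h8 := hentry k l
  rwa [h7, ite_self, add_zero] at h8

theorem IsHeisenberg.cupProductTrivial [CharZero F] [FiniteDimensional F g]
    {L : LieSuperalgebra F g} (hL : L.IsHeisenberg) : L.CupProductTrivial := by
  obtain ⟨ι, _, _, ⟨B⟩⟩ := hL.exists_heisenbergBasis
  exact B.cupProductTrivial

/-! ### The two families -/

section Families

variable (F)

theorem isHeisenberg_of_center (L : LieSuperalgebra F g) {z : g} (hz : z ≠ 0)
    (hspan : ∀ x y, ∃ c : F, L.bracket x y = c • z) (hzero : ∀ x, L.bracket x z = 0)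
    (hcenter : L.center ≤ Submodule.span F {z}) (hne : L.bracket ≠ 0) : L.IsHeisenberg := by
  refine ⟨⟨fun h => hne ?_, ?_⟩, ?_⟩
  · ext x y
    have : L.bracket x y ∈ L.lowerCentral 1 := Submodule.subset_span ⟨x, y, trivial, rfl⟩
    rwa [h, Submodule.mem_bot] at this
  · refine Submodule.span_eq_bot.2 ?_
    rintro w ⟨x, y, hy, rfl⟩
    have h1 : L.lowerCentral 1 ≤ Submodule.span F {z} := by
      refine Submodule.span_le.2 ?_
      rintro w ⟨a, b, -, rfl⟩
      obtain ⟨c, hc⟩ := hspan a b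
      rw [hc]
      exact Submodule.smul_mem _ _ (Submodule.mem_span_singleton_self z)
    obtain ⟨c, rfl⟩ := Submodule.mem_span_singleton.1 (h1 hy)
    rw [map_smul, hzero, smul_zero]
  · rw [le_antisymm hcenter ((Submodule.span_singleton_le_iff_mem _ _).2
      (L.mem_center_of_bracket_right hzero)), finrank_span_singleton hz]

theorem heisenbergEven_isHeisenberg {m n : ℕ} (h : m ≠ 0 ∨ n ≠ 0) :
    (heisenbergEven F m n).IsHeisenberg := by
  refine isHeisenberg_of_center F _
    (z := ((1, 0, 0, 0) : F × (Fin m → F) × (Fin m → F) × (Fin n → F))) (by simp) ?_ ?_ ?_ ?_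
  · intro x y
    exact ⟨((heisenbergEven F m n).bracket x y).1, by simp [heisenbergEven, heisenbergEvenBracket]⟩
  · intro x
    simp [heisenbergEven, heisenbergEvenBracket]
  · rintro ⟨c, a, b, r⟩ hx
    have hx' : ∀ y, (heisenbergEvenBracket F m n (c, a, b, r) y).1 = 0 := fun y =>
      congrArg Prod.fst (LinearMap.congr_fun (LinearMap.mem_ker.1 hx) y)
    rw [Submodule.mem_span_singleton]
    refine ⟨c, ?_⟩
    have ha : a = 0 := funext fun i => by
      simpa [heisenbergEvenBracket, Pi.single_apply] using hx' (0, 0, Pi.single i 1, 0)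
    have hb : b = 0 := funext fun i => by
      simpa [heisenbergEvenBracket, Pi.single_apply] using hx' (0, Pi.single i 1, 0, 0)
    have hr : r = 0 := funext fun i => by
      simpa [heisenbergEvenBracket, Pi.single_apply] using hx' (0, 0, 0, Pi.single i 1)
    simp [ha, hb, hr]
  · intro h0
    have h0' : ∀ x y, (heisenbergEvenBracket F m n x y).1 = 0 := fun x y =>
      congrArg Prod.fst (LinearMap.congr_fun (LinearMap.congr_fun h0 x) y)
    rcases h with h | h
    · have := h0' (0, Pi.single ⟨0, Nat.pos_of_ne_zero h⟩ 1, 0, 0)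
        (0, 0, Pi.single ⟨0, Nat.pos_of_ne_zero h⟩ 1, 0)
      simp [heisenbergEvenBracket, Pi.single_apply] at this
    · have := h0' (0, 0, 0, Pi.single ⟨0, Nat.pos_of_ne_zero h⟩ 1)
        (0, 0, 0, Pi.single ⟨0, Nat.pos_of_ne_zero h⟩ 1)
      simp [heisenbergEvenBracket, Pi.single_apply] at this

theorem heisenbergOdd_isHeisenberg {n : ℕ} (h : n ≠ 0) : (heisenbergOdd F n).IsHeisenberg := by
  refine isHeisenberg_of_center F _ (z := ((1, 0, 0) : F × (Fin n → F) × (Fin n → F)))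
    (by simp) ?_ ?_ ?_ ?_
  · intro x y
    exact ⟨((heisenbergOdd F n).bracket x y).1, by simp [heisenbergOdd, heisenbergOddBracket]⟩
  · intro x
    simp [heisenbergOdd, heisenbergOddBracket]
  · rintro ⟨c, a, b⟩ hx
    have hx' : ∀ y, (heisenbergOddBracket F n (c, a, b) y).1 = 0 := fun y =>
      congrArg Prod.fst (LinearMap.congr_fun (LinearMap.mem_ker.1 hx) y)
    rw [Submodule.mem_span_singleton]
    refine ⟨c, ?_⟩
    have ha : a = 0 := funext fun i => by
      simpa [heisenbergOddBracket, Pi.single_apply] using hx' (0, 0, Pi.single i 1)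
    have hb : b = 0 := funext fun i => by
      simpa [heisenbergOddBracket, Pi.single_apply] using hx' (0, Pi.single i 1, 0)
    simp [ha, hb]
  · intro h0
    have := congrArg Prod.fst (LinearMap.congr_fun (LinearMap.congr_fun h0
      (0, Pi.single ⟨0, Nat.pos_of_ne_zero h⟩ 1, 0)) (0, 0, Pi.single ⟨0, Nat.pos_of_ne_zero h⟩ 1))
    simp [heisenbergOdd, heisenbergOddBracket, Pi.single_apply] at this

end Families

end LieSuperalgebra

theorem mainTheorem1 (F : Type*) [Field F] [IsAlgClosed F] [CharZero F] :
    (∀ (g : Type*) [AddCommGroup g] [Module F g] [FiniteDimensional F g]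
        (L : LieSuperalgebra F g), L.IsHeisenberg → L.CupProductTrivial) ∧
      (∀ m n : ℕ, (LieSuperalgebra.heisenbergEven F m n).CupProductTrivial) ∧
      (∀ n : ℕ, (LieSuperalgebra.heisenbergOdd F n).CupProductTrivial) := by
  refine ⟨fun g _ _ _ L hL => hL.cupProductTrivial, fun m n => ?_, fun n => ?_⟩
  · by_cases h : m ≠ 0 ∨ n ≠ 0
    · exact (LieSuperalgebra.heisenbergEven_isHeisenberg F h).cupProductTrivial
    · push Not at h
      obtain ⟨rfl, rfl⟩ := h
      refine LieSuperalgebra.cupProductTrivial_of_bracket_eq_zero _ ?_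
      refine LinearMap.ext fun x => LinearMap.ext fun y => ?_
      simp [LieSuperalgebra.heisenbergEven, LieSuperalgebra.heisenbergEvenBracket]
  · by_cases h : n ≠ 0
    · exact (LieSuperalgebra.heisenbergOdd_isHeisenberg F h).cupProductTrivial
    · push Not at h
      obtain rfl := h
      refine LieSuperalgebra.cupProductTrivial_of_bracket_eq_zero _ ?_
      refine LinearMap.ext fun x => LinearMap.ext fun y => ?_
      simp [LieSuperalgebra.heisenbergOdd, LieSuperalgebra.heisenbergOddBracket]
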